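/- Let $(u:v:w)$ be homogeneous coordinates on the dual plane $(\mathbb P^2)^\vee$ and let $c,d\ge 0$ be integers. Let $W_{c,0,d}$ be the family of irreducible rational complex plane curves of degree $c$ and class $d$ in $(\mathbb P^2)^\vee$ (the class is the number of tangents to the curve through a general point), considered on the affine chart of forms $G(u,v,w)$ of degree $c$ in which the coefficient of $w^c$ equals $1$; let $W_{c,0,d}(\mathbb R)$ be the subset of forms with real coefficients. The focal map is $$\Phi\colon W_{c,0,d}(\mathbb R)\to \mathbb C[w]_{\le c-1}\cong\mathbb R^{2c},\qquad \Phi(G)=G(-1,-i,w)-w^c .$$ For a nodal-cuspidal curve $D=\{G=0\}$ (one whose only singularities are nodes and ordinary cusps) let $Z^{\rm ec}$ be its equiclassical scheme: it is supported on the singular points of $D$, with ideal the maximal ideal at a node, and $(x^2,y)$ at a cusp with local equation $y^2=x^3$. Let $W\subseteq W_{c,0,d}(\mathbb R)$ be an irreducible component (in the Zariski topology). Assume that at a general point $G$ of $W$: 1. $W$ is smooth of the expected dimension $c+d+1$; 2. $D=\{G=0\}$ is nodal-cuspidal, and none of its singular points lies on the conic $u^2+v^2=0$; 3. the usual equiclassical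 tangent-space description holds: the complex Zariski tangent space of $W_{c,0,d}$ at $G$ is the space of all $H\in H^0(\mathcal I_{Z^{\rm ec}}(c))$ whose $w^c$-coefficient is zero. Then, at a general (smooth) point $G$ of $W$, the differential $d\Phi_G\colon T_GW\to\mathbb R^{2c}$ satisfies $$\dim_{\mathbb R}\ker(d\Phi_G)=\max(0,d-c+1),\qquad \operatorname{rank}(d\Phi_G)=\min(2c,c+d+1),$$ and the expected local dimension of the confocal locus through $G$, that is, the dimension of the Zariski tangent space at $G$ of the fibre of $\Phi|_W$ through $G$, is $\max(0,d-c+1)$. -/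

import Mathlib

noncomputable section

namespace Confocal

open MvPolynomial

/-! ### Plane curves of degree `c` in the dual plane, coordinates `(u, v, w) = (X 0, X 1, X 2)` -/

/-- Exponents of the monomials of degree `c` in the three variables `u, v, w`. -/
abbrev Mono (c : ℕ) : Type :=
  {m : Fin 3 →₀ ℕ // m ∈ (Finset.univ : Finset (Fin 3)).finsuppAntidiag c}

/-- The exponent of the monomial `w ^ c`. -/
def wTop (c : ℕ) : Mono c :=
  ⟨Finsupp.single 2 c, by simp [Finset.mem_finsuppAntidiag]⟩

/-- The ternary form of degree `c` with coefficient vector `a`. -/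
def form {K : Type*} [CommRing K] {c : ℕ} (a : Mono c → K) : MvPolynomial (Fin 3) K :=
  ∑ m : Mono c, monomial m.1 (a m)

/-- A real coefficient vector, regarded as a complex one. -/
def complexify {c : ℕ} (a : Mono c → ℝ) : Mono c → ℂ := fun m => (a m : ℂ)

/-- The gradient of `G` at `p`. -/
def grad (G : MvPolynomial (Fin 3) ℂ) (p : Fin 3 → ℂ) : Fin 3 → ℂ :=
  fun i => eval p (pderiv i G)

/-- The Hessian matrix of `G` at `p`. -/
def hess (G : MvPolynomial (Fin 3) ℂ) (p : Fin 3 → ℂ) : Matrix (Fin 3) (Fin 3) ℂ :=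
  Matrix.of fun i j => eval p (pderiv i (pderiv j G))

/-- The third derivative of `G` at `p` in the direction `v`. -/
def thirdDeriv (G : MvPolynomial (Fin 3) ℂ) (p v : Fin 3 → ℂ) : ℂ :=
  ∑ i, ∑ j, ∑ k, eval p (pderiv i (pderiv j (pderiv k G))) * (v i * v j * v k)

/-! ### Rationality and class -/

/-- The curve `G = 0` of degree `c` is rational: it is the image of `ℙ¹` under a morphism, given by
binary forms of degree `c` without common zero, that is birational onto the curve (the fibre
through a general point of `ℙ¹` consists of this point only). -/
def IsRational (c : ℕ) (G : MvPolynomial (Fin 3) ℂ) : Prop :=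
  ∃ φ : Fin 3 → MvPolynomial (Fin 2) ℂ,
    (∀ i, (φ i).IsHomogeneous c) ∧
    (∀ t : Fin 2 → ℂ, t ≠ 0 → ∃ i, eval t (φ i) ≠ 0) ∧
    (∀ t : Fin 2 → ℂ, eval (fun i => eval t (φ i)) G = 0) ∧
    ∃ R : MvPolynomial (Fin 2) ℂ, R ≠ 0 ∧
      ∀ s t : Fin 2 → ℂ, s ≠ 0 → t ≠ 0 → eval s R ≠ 0 →
        (∃ r : ℂ, (fun i => eval t (φ i)) = r • (fun i => eval s (φ i))) →
        ∃ r : ℂ, t = r • s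

/-- The points of contact of the tangents that can be drawn from `q` to the curve `G = 0`: the
nonsingular points `p` of the curve whose tangent line `∑ i, (∂G/∂xᵢ)(p) xᵢ = 0` contains `q`. -/
def contactPoints (G : MvPolynomial (Fin 3) ℂ) (q : Fin 3 → ℂ) :
    Set (Projectivization ℂ (Fin 3 → ℂ)) :=
  {p | eval p.rep G = 0 ∧ grad G p.rep ≠ 0 ∧ ∑ i, grad G p.rep i * q i = 0}

/-- The class of the curve `G = 0` is `d`: from a general point of the plane exactly `d` tangents
can be drawn to the curve. -/
def HasClass (G : MvPolynomial (Fin 3) ℂ) (d : ℕ) : Prop :=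
  ∃ R : MvPolynomial (Fin 3) ℂ, R ≠ 0 ∧
    ∀ q : Fin 3 → ℂ, eval q R ≠ 0 → (contactPoints G q).encard = (d : ℕ∞)

/-! ### The equiclassical families -/

/-- The family of irreducible rational curves of degree `c` and class `d` over `ℂ`, on the affine
chart on which the coefficient of `w ^ c` is `1`. -/
def family (c d : ℕ) : Set (Mono c → ℂ) :=
  {a | a (wTop c) = 1 ∧ Irreducible (form a) ∧ IsRational c (form a) ∧ HasClass (form a) d}

/-- The real members of the family. -/
def realFamily (c d : ℕ) : Set (Mono c → ℝ) :=
  {a | complexify a ∈ family c d}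

/-- `W` is an irreducible component of `S` in the Zariski topology: a maximal irreducible subset
(a subset is irreducible iff its vanishing ideal is prime). -/
def IsIrredComponent {K σ : Type*} [Field K] (S W : Set (σ → K)) : Prop :=
  Maximal (fun T : Set (σ → K) => T ⊆ S ∧ (vanishingIdeal K T).IsPrime) W

/-- `P` holds at a general point of `W`, i.e. on a nonempty Zariski-open subset of `W`. -/
def Generally {K σ : Type*} [Field K] (W : Set (σ → K)) (P : (σ → K) → Prop) : Prop :=
  ∃ f : MvPolynomial σ K, (∃ a ∈ W, eval a f ≠ 0) ∧ ∀ a ∈ W, eval a f ≠ 0 → P a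

/-- The Zariski tangent space at `a` of the closed subscheme of affine space with ideal `I`. -/
def idealTangent {K σ : Type*} [Field K] [Fintype σ] (I : Ideal (MvPolynomial σ K)) (a : σ → K) :
    Submodule K (σ → K) where
  carrier := {h | ∀ f ∈ I, ∑ m, eval a (pderiv m f) * h m = 0}
  add_mem' := by
    intro x y hx hy f hf
    simp [mul_add, Finset.sum_add_distrib, hx f hf, hy f hf]
  zero_mem' := by
    intro f _
    simp
  smul_mem' := by
    intro r x hx f hf
    have h : ∑ m, eval a (pderiv m f) * (r • x) m = r * ∑ m, eval a (pderiv m f) * x m := by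
      rw [Finset.mul_sum]
      refine Finset.sum_congr rfl fun m _ => ?_
      simp only [Pi.smul_apply, smul_eq_mul]
      ring
    rw [h, hx f hf, mul_zero]

/-- The Zariski tangent space of `W` (with its reduced structure) at `a`. -/
def tangent {K σ : Type*} [Field K] [Fintype σ] (W : Set (σ → K)) (a : σ → K) :
    Submodule K (σ → K) :=
  idealTangent (vanishingIdeal K W) a

/-- The irreducible variety `W` has dimension `n` and is smooth at its point `a`. -/
def IsSmoothOfDim {K σ : Type*} [Field K] [Fintype σ] (W : Set (σ → K)) (n : ℕ) (a : σ → K) :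
    Prop :=
  ringKrullDim (MvPolynomial σ K ⧸ vanishingIdeal K W) = n ∧ Module.finrank K (tangent W a) = n

/-! ### Nodes, cusps and the equiclassical scheme -/

/-- `p` represents a singular point of the curve `G = 0`. -/
def IsSingularPoint (G : MvPolynomial (Fin 3) ℂ) (p : Fin 3 → ℂ) : Prop :=
  p ≠ 0 ∧ eval p G = 0 ∧ grad G p = 0

/-- `p` is a node: a double point with two distinct tangent directions, that is, the Hessian (whose
kernel contains `p`) induces a nondegenerate quadratic form on the tangent plane `ℂ³ / p`. -/
def IsNode (G : MvPolynomial (Fin 3) ℂ) (p : Fin 3 → ℂ) : Prop :=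
  IsSingularPoint G p ∧ (hess G p).rank = 2

/-- `p` is an ordinary cusp: a double point with only one tangent direction, which is the kernel of
the Hessian modulo `p`, such that the cubic term of `G` at `p` does not vanish on this direction. -/
def IsCusp (G : MvPolynomial (Fin 3) ℂ) (p : Fin 3 → ℂ) : Prop :=
  IsSingularPoint G p ∧ (hess G p).rank = 1 ∧
    ∃ v : Fin 3 → ℂ, (hess G p).mulVec v = 0 ∧ thirdDeriv G p v ≠ 0

/-- All singular points of the curve `G = 0` are nodes or ordinary cusps. -/
def IsNodalCuspidal (G : MvPolynomial (Fin 3) ℂ) : Prop :=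
  ∀ p, IsSingularPoint G p → IsNode G p ∨ IsCusp G p

/-- The form `H` is a section of the ideal sheaf of the equiclassical scheme of the nodal-cuspidal
curve `G = 0`. The ideal of this scheme is the maximal ideal at a node, and `(x², y)` at an ordinary
cusp with local equation `y² = x³`: `H` vanishes at the nodes and the cusps, and at a cusp also its
derivative in the direction of the cuspidal tangent vanishes. -/
def InEquiclassicalIdeal (G H : MvPolynomial (Fin 3) ℂ) : Prop :=
  (∀ p, IsNode G p → eval p H = 0) ∧
  (∀ p, IsCusp G p → eval p H = 0 ∧
    ∀ v : Fin 3 → ℂ, (hess G p).mulVec v = 0 → ∑ i, grad H p i * v i = 0)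

/-- The equiclassical tangent-space description at the point `a` of the complex family: on the chart
where the coefficient of `w ^ c` is `1`, the complex Zariski tangent space of the family consists of
the sections of `I(c)` with zero coefficient at `w ^ c`, for the ideal sheaf `I` of the
equiclassical scheme. -/
def TangentDescription (c d : ℕ) (a : Mono c → ℂ) : Prop :=
  ∀ h : Mono c → ℂ,
    h ∈ tangent (family c d) a ↔ h (wTop c) = 0 ∧ InEquiclassicalIdeal (form a) (form h)

/-- No singular point of the curve `G = 0` lies on the conic `u² + v² = 0`. -/
def SingDisjointFromIsotropic (G : MvPolynomial (Fin 3) ℂ) : Prop :=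
  ∀ p, IsSingularPoint G p → p 0 ^ 2 + p 1 ^ 2 ≠ 0

/-! ### The focal map -/

/-- The polynomial `G₊(w) = G(-1, -i, w)`. -/
def focalPoly {c : ℕ} (a : Mono c → ℝ) : Polynomial ℂ :=
  aeval ![(-1 : Polynomial ℂ), -Polynomial.C Complex.I, Polynomial.X] (form (complexify a))

/-- The focal map `G ↦ G₊(w) - w ^ c`, with values in the space of complex polynomials of degree
less than `c`, identified with `ℂ ^ c` through the coefficients. -/
def focalMap (c : ℕ) (a : Mono c → ℝ) : Fin c → ℂ :=
  fun k => (focalPoly a - Polynomial.X ^ c).coeff k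

/-- The real differential at `a` of the restriction of the focal map to `W`. -/
def focalDifferential {c : ℕ} (W : Set (Mono c → ℝ)) (a : Mono c → ℝ) :
    tangent W a →ₗ[ℝ] (Fin c → ℂ) :=
  (fderiv ℝ (focalMap c) a).toLinearMap.domRestrict (tangent W a)

/-- The Zariski tangent space at `a` of the confocal locus through `a`: the fibre of the focal map
on `W` through `a`, that is, the scheme-theoretic intersection of `W` with the affine subspace
of all forms with the same image under the focal map. -/
def confocalTangent {c : ℕ} (W : Set (Mono c → ℝ)) (a : Mono c → ℝ) :
    Submodule ℝ (Mono c → ℝ) :=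
  idealTangent (vanishingIdeal ℝ W ⊔ vanishingIdeal ℝ {b | focalMap c b = focalMap c a}) a

/-- The expected local dimension at `a` of the confocal locus in `W` through `a`: the dimension of
its Zariski tangent space. -/
def expectedConfocalDim {c : ℕ} (W : Set (Mono c → ℝ)) (a : Mono c → ℝ) : ℕ :=
  Module.finrank ℝ (confocalTangent W a)

end Confocal

end

noncomputable section

namespace Confocal

open MvPolynomial

/-! ### Homogeneous polynomials along polynomial arcs -/

section Homogeneous

/-! The focal map is the restriction of a linear map, so the kernel of its differential at `G`
consists of the real tangent vectors `H` with `H(-1, -i, w) = 0`. Homogeneity turns this into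
vanishing on one isotropic line, and reality of `H` adds the conjugate line. Hence `H` vanishes on
the whole conic `u² + v² = 0`, and it is an equiclassical section of degree `c` by the tangent-space
description.

Such sections are counted on `ℙ¹`. Let `p` be a parametrization of degree `c` of the curve `D`. The
pullback of `H` has degree at most `c²` and is divisible by two coprime polynomials: - the common
factor `A` of the partial derivatives of `G` along `p`. At nodes and cusps the equiclassical ideal
is the Jacobian ideal, so `H` vanishes along any branch at least as much as the gradient does
(`equiclassical_arc_dvd`). Dividing the gradient by `A` gives the dual parametrization, whose degree
is at most the class, so `deg A ≥ c(c-1) - d` (`exists_gradient_factor`); - the pullback `Q` of the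
conic, of degree `2c` (`IsParametrization.conic_dvd`). It is coprime to `A` because no singular
point lies on the conic.

Pulling back is injective on these sections: a general line meets `D` together with the conic in `c
+ 2` points, too many for a nonzero form of degree `c` (`IsParametrization.eq_zero_of_conic`). So
the kernel has dimension at most `c² + 1 - deg A - 2c ≤ d - c + 1`, or is zero when this bound is
negative (`finrank_equiclassical_le`).

The reverse inequality is rank-nullity: the source has dimension `c + d + 1` and the target `2c`.
The tangent space of the fibre is the same kernel, since the fibre of a linear map is an affine
subspace (`confocalTangent_eq`). -/

theorem prod_pow_natDegree_coeff {σ K : Type*} [Field K] (p : σ → Polynomial K) (e : ℕ) (hp : ∀ i, (p i).natDegree ≤ e)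
    (m : σ → ℕ) (s : Finset σ) :
    (∏ i ∈ s, p i ^ m i).natDegree ≤ (∑ i ∈ s, m i) * e ∧
      (∏ i ∈ s, p i ^ m i).coeff ((∑ i ∈ s, m i) * e) = ∏ i ∈ s, (p i).coeff e ^ m i := by
  classical
  induction s using Finset.induction_on with
  | empty => simp
  | insert a s ha ih =>
    have h1 : (p a ^ m a).natDegree ≤ m a * e :=
      Polynomial.natDegree_pow_le_of_le _ (hp a)
    rw [Finset.prod_insert ha, Finset.sum_insert ha, Finset.prod_insert ha, add_mul]
    refine ⟨Polynomial.natDegree_mul_le_of_le h1 ih.1, ?_⟩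
    rw [Polynomial.coeff_mul_add_eq_of_natDegree_le h1 ih.1, ih.2,
      Polynomial.coeff_pow_of_natDegree_le (hp a)]

variable {σ K S : Type*} [Fintype σ] [Field K] [CommRing S] [Algebra K S]

theorem sum_exponents_of_isHomogeneous {F : MvPolynomial σ K} {n : ℕ} (hF : F.IsHomogeneous n)
    {m : σ →₀ ℕ} (hm : m ∈ F.support) : ∑ i, m i = n := by
  rw [hF.degree_eq_sum_deg_support hm]
  exact (Finset.sum_subset (Finset.subset_univ _) fun i _ hi => by simpa using hi).symm

theorem aeval_smul_of_isHomogeneous {F : MvPolynomial σ K} {n : ℕ} (hF : F.IsHomogeneous n)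
    (r : S) (x : σ → S) : aeval (fun i => r * x i) F = r ^ n * aeval x F := by
  rw [aeval_def, aeval_def, eval₂_eq', eval₂_eq', Finset.mul_sum]
  refine Finset.sum_congr rfl fun m hm => ?_
  have h := sum_exponents_of_isHomogeneous hF hm
  simp only [mul_pow, Finset.prod_mul_distrib, Finset.prod_pow_eq_pow_sum, h]
  ring

theorem eval_smul_of_isHomogeneous {F : MvPolynomial σ K} {n : ℕ} (hF : F.IsHomogeneous n)
    (r : K) (x : σ → K) : eval (r • x) F = r ^ n * eval x F := by
  have := aeval_smul_of_isHomogeneous hF r x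
  rw [aeval_eq_eval] at this
  exact this

/-- Padding every coordinate to formal degree `e` makes the top coefficient the value at the point
at infinity of the arc. Degrees along parametrizations are controlled this way. -/
theorem aeval_natDegree_coeff {F : MvPolynomial σ K} {n : ℕ} (hF : F.IsHomogeneous n)
    (p : σ → Polynomial K) (e : ℕ) (hp : ∀ i, (p i).natDegree ≤ e) :
    (aeval p F).natDegree ≤ n * e ∧
      (aeval p F).coeff (n * e) = eval (fun i => (p i).coeff e) F := by
  have key : ∀ m ∈ F.support, ∑ i, m i = n := fun m hm => sum_exponents_of_isHomogeneous hF hm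
  rw [aeval_def, eval₂_eq']
  constructor
  · refine Polynomial.natDegree_sum_le_of_forall_le _ _ fun m hm => ?_
    refine (Polynomial.natDegree_C_mul_le _ _).trans ?_
    have := (prod_pow_natDegree_coeff p e hp m Finset.univ).1
    rwa [key m hm] at this
  · rw [Polynomial.finsetSum_coeff, eval_eq']
    refine Finset.sum_congr rfl fun m hm => ?_
    have := (prod_pow_natDegree_coeff p e hp m Finset.univ).2
    rw [key m hm] at this
    rw [Polynomial.algebraMap_eq, Polynomial.coeff_C_mul, this]

theorem polynomial_eval_aeval (p : σ → Polynomial K) (F : MvPolynomial σ K) (t : K) :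
    (aeval p F).eval t = eval (fun i => (p i).eval t) F := by
  rw [aeval_def, eval₂_eq', eval_eq', Polynomial.eval_finsetSum]
  simp [Polynomial.eval_prod]

/-- The remainder is quadratic in `y`. Working modulo an ideal lets the same expansion serve for
powers of `X - t` and for tangent vectors modulo `X ^ 2`. -/
theorem taylor_one (F : MvPolynomial σ K) (x y : σ → S) (I : Ideal S)
    (hI : ∀ i j, y i * y j ∈ I) :
    aeval (x + y) F - aeval x F - ∑ i, aeval x (pderiv i F) * y i ∈ I := by
  classical
  induction F using MvPolynomial.induction_on with
  | C a => simp
  | add F G hF hG =>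
    convert! I.add_mem hF hG using 1
    simp only [map_add, add_mul, Finset.sum_add_distrib]
    ring
  | mul_X F n hF =>
    have h : ∑ i, aeval x (pderiv i F) * y i * y n ∈ I :=
      Ideal.sum_mem _ fun i _ => by
        rw [mul_assoc]
        exact I.mul_mem_left _ (hI i n)
    convert! I.add_mem (I.mul_mem_right (x n + y n) hF) h using 1
    have e : ∑ i, aeval x (pderiv i (F * X n)) * y i
        = (∑ i, aeval x (pderiv i F) * y i) * x n + aeval x F * y n := by
      simp only [pderiv_mul, pderiv_X, map_add, map_mul, aeval_X, add_mul,
        Finset.sum_add_distrib, Finset.sum_mul]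
      congr 1
      · exact Finset.sum_congr rfl fun i _ => by ring
      · rw [Finset.sum_eq_single n]
        · simp
        · intro i _ hi
          simp [hi.symm]
        · simp
    rw [e, ← Finset.sum_mul]
    simp only [map_mul, aeval_X, Pi.add_apply]
    ring

/-- Everything is multiplied by two so that the second-order term needs no division. -/
theorem taylor_two (F : MvPolynomial σ K) (x y : σ → S) (I : Ideal S)
    (hI : ∀ i j k, y i * y j * y k ∈ I) :
    2 * aeval (x + y) F - 2 * aeval x F - 2 * ∑ i, aeval x (pderiv i F) * y i
      - ∑ i, ∑ j, aeval x (pderiv i (pderiv j F)) * (y i * y j) ∈ I := by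
  classical
  induction F using MvPolynomial.induction_on with
  | C a => simp
  | add F G hF hG =>
    convert! I.add_mem hF hG using 1
    simp only [map_add, add_mul, Finset.sum_add_distrib]
    ring
  | mul_X F n hF =>
    have h : ∑ i, ∑ j, aeval x (pderiv i (pderiv j F)) * (y i * y j) * y n ∈ I :=
      Ideal.sum_mem _ fun i _ => Ideal.sum_mem _ fun j _ => by
        rw [mul_assoc]
        exact I.mul_mem_left _ (hI i j n)
    convert! I.add_mem (I.mul_mem_right (x n + y n) hF) h using 1
    have single : ∀ (f : σ → S), ∑ i, f i * aeval x ((Pi.single n 1 : σ → MvPolynomial σ K) i)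
        = f n := fun f => by
      rw [Finset.sum_eq_single n]
      · simp
      · intro i _ hi
        simp [hi]
      · simp
    have hX : ∀ i, pderiv i (X n : MvPolynomial σ K) = (Pi.single n 1 : σ → MvPolynomial σ K) i :=
      fun i => by
        rw [pderiv_X]
        by_cases hi : i = n
        · subst hi; simp
        · rw [Pi.single_eq_of_ne hi, Pi.single_eq_of_ne (Ne.symm hi)]
    have hS : ∀ i j, pderiv i ((Pi.single n 1 : σ → MvPolynomial σ K) j) = 0 := fun i j => by
      by_cases hj : j = n
      · subst hj; simp
      · simp [hj]
    have e : ∑ i, aeval x (pderiv i (F * X n)) * y i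
        = (∑ i, aeval x (pderiv i F) * y i) * x n + aeval x F * y n := by
      have := single (fun i => aeval x F * y i)
      rw [← this, Finset.sum_mul, ← Finset.sum_add_distrib]
      refine Finset.sum_congr rfl fun i _ => ?_
      simp only [pderiv_mul, hX, map_add, map_mul, aeval_X]
      ring
    have e2 : ∑ i, ∑ j, aeval x (pderiv i (pderiv j (F * X n))) * (y i * y j)
        = (∑ i, ∑ j, aeval x (pderiv i (pderiv j F)) * (y i * y j)) * x n
          + 2 * (∑ i, aeval x (pderiv i F) * y i) * y n := by
      have s1 : ∑ i, ∑ j, aeval x (pderiv j F) * (y i * y j)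
          * aeval x ((Pi.single n 1 : σ → MvPolynomial σ K) i)
          = (∑ j, aeval x (pderiv j F) * y j) * y n := by
        rw [Finset.sum_comm, Finset.sum_mul]
        refine Finset.sum_congr rfl fun j _ => ?_
        rw [single (fun i => aeval x (pderiv j F) * (y i * y j))]
        ring
      have s2 : ∑ i, ∑ j, aeval x (pderiv i F) * (y i * y j)
          * aeval x ((Pi.single n 1 : σ → MvPolynomial σ K) j)
          = (∑ j, aeval x (pderiv j F) * y j) * y n := by
        rw [Finset.sum_mul]
        refine Finset.sum_congr rfl fun j _ => ?_
        rw [single (fun i => aeval x (pderiv j F) * (y j * y i))]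
        ring
      rw [mul_assoc, two_mul]
      nth_rewrite 1 [← s1]
      rw [← s2, Finset.sum_mul, ← Finset.sum_add_distrib, ← Finset.sum_add_distrib]
      refine Finset.sum_congr rfl fun i _ => ?_
      rw [Finset.sum_mul, ← Finset.sum_add_distrib, ← Finset.sum_add_distrib]
      refine Finset.sum_congr rfl fun j _ => ?_
      simp only [pderiv_mul, hX, hS, map_add, map_mul, aeval_X, map_zero]
      ring
    rw [e, e2]
    simp only [← Finset.sum_mul, map_mul, aeval_X, Pi.add_apply]
    ring

end Homogeneous

/-! ### Order of vanishing along an arc through a node or a cusp -/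

theorem pderiv_comm {σ R : Type*} [CommRing R] (i j : σ) (F : MvPolynomial σ R) :
    pderiv i (pderiv j F) = pderiv j (pderiv i F) := by
  classical
  have h : ⁅pderiv (R := R) i, pderiv (R := R) j⁆ = 0 := by
    refine MvPolynomial.derivation_ext fun k => ?_
    rw [Derivation.commutator_apply]
    simp only [pderiv_X, Derivation.zero_apply]
    by_cases h1 : j = k <;> by_cases h2 : i = k <;> simp [h1, h2]
  have := DFunLike.congr_fun h F
  rw [Derivation.commutator_apply] at this
  exact sub_eq_zero.mp this

section Arc

variable {p : Fin 3 → Polynomial ℂ} {l ξ η : Polynomial ℂ} {P v w : Fin 3 → ℂ}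

theorem aeval_C_mul_of_isHomogeneous {F : MvPolynomial (Fin 3) ℂ} {n : ℕ} (hF : F.IsHomogeneous n)
    (l : Polynomial ℂ) (P : Fin 3 → ℂ) :
    aeval (fun i => l * Polynomial.C (P i)) F = l ^ n * Polynomial.C (eval P F) := by
  rw [aeval_smul_of_isHomogeneous hF l (fun i => Polynomial.C (P i))]
  congr 1
  rw [aeval_def, eval₂_eq', eval_eq', map_sum]
  simp

theorem arc_expansion_one {F : MvPolynomial (Fin 3) ℂ} {n : ℕ} (hF : F.IsHomogeneous n)
    (hp : ∀ i, p i = l * Polynomial.C (P i) + (ξ * Polynomial.C (v i) + η * Polynomial.C (w i)))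
    (I : Ideal (Polynomial ℂ)) (h1 : ξ * ξ ∈ I) (h2 : ξ * η ∈ I) (h3 : η * η ∈ I) :
    aeval p F - (l ^ n * Polynomial.C (eval P F) + l ^ (n - 1) *
      (ξ * Polynomial.C (∑ i, grad F P i * v i) + η * Polynomial.C (∑ i, grad F P i * w i)))
      ∈ I := by
  have hp' : p = (fun i => l * Polynomial.C (P i)) +
      (fun i => ξ * Polynomial.C (v i) + η * Polynomial.C (w i)) := funext hp
  have := taylor_one F (fun i => l * Polynomial.C (P i))
    (fun i => ξ * Polynomial.C (v i) + η * Polynomial.C (w i)) I (fun i j => by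
      have e : (ξ * Polynomial.C (v i) + η * Polynomial.C (w i)) *
          (ξ * Polynomial.C (v j) + η * Polynomial.C (w j)) =
          Polynomial.C (v i) * Polynomial.C (v j) * (ξ * ξ) +
          (Polynomial.C (v i) * Polynomial.C (w j) + Polynomial.C (w i) * Polynomial.C (v j))
            * (ξ * η) + Polynomial.C (w i) * Polynomial.C (w j) * (η * η) := by ring
      rw [e]
      exact I.add_mem (I.add_mem (I.mul_mem_left _ h1) (I.mul_mem_left _ h2))
        (I.mul_mem_left _ h3))
  rw [← hp', aeval_C_mul_of_isHomogeneous hF] at this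
  convert! this using 1
  rw [sub_sub]
  congr 2
  simp only [aeval_C_mul_of_isHomogeneous hF.pderiv, map_sum, Polynomial.C_mul, grad,
    Finset.mul_sum, ← Finset.sum_add_distrib]
  exact Finset.sum_congr rfl fun i _ => by ring

/-- Here `ξ` may have lower order than `η`, as on a cuspidal branch: `ξ²` survives modulo `I`, while
`ξ³`, `ξη` and `η²` do not. -/
theorem arc_expansion_two {F : MvPolynomial (Fin 3) ℂ} {n : ℕ} (hF : F.IsHomogeneous n)
    (hp : ∀ i, p i = l * Polynomial.C (P i) + (ξ * Polynomial.C (v i) + η * Polynomial.C (w i)))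
    (hP : eval P F = 0) (hgrad : grad F P = 0)
    (I : Ideal (Polynomial ℂ)) (h1 : ξ * ξ * ξ ∈ I) (h2 : ξ * η ∈ I) (h3 : η * η ∈ I) :
    2 * aeval p F - l ^ (n - 1 - 1) *
      (ξ * ξ * Polynomial.C (∑ i, ∑ j, eval P (pderiv i (pderiv j F)) * (v i * v j))) ∈ I := by
  obtain ⟨y, hy⟩ : ∃ y : Fin 3 → Polynomial ℂ,
      y = fun i => ξ * Polynomial.C (v i) + η * Polynomial.C (w i) := ⟨_, rfl⟩
  have hp' : p = (fun i => l * Polynomial.C (P i)) + y := by rw [hy]; exact funext hp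
  have hmul : ∀ i j, ∃ r : Polynomial ℂ, r ∈ I ∧
      y i * y j = Polynomial.C (v i * v j) * (ξ * ξ) + r := fun i j => by
    refine ⟨(Polynomial.C (v i) * Polynomial.C (w j) + Polynomial.C (w i) * Polynomial.C (v j))
            * (ξ * η) + Polynomial.C (w i) * Polynomial.C (w j) * (η * η), ?_, ?_⟩
    · exact I.add_mem (I.mul_mem_left _ h2) (I.mul_mem_left _ h3)
    · rw [hy, Polynomial.C_mul]; ring
  choose r hr e using hmul
  have hcube : ∀ i j k, y i * y j * y k ∈ I := fun i j k => by
    have e' : y i * y j * y k = Polynomial.C (v i * v j) * Polynomial.C (v k) * (ξ * ξ * ξ) +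
        Polynomial.C (v i * v j) * Polynomial.C (w k) * ξ * (ξ * η) + y k * r i j := by
      rw [e i j, hy]; ring
    rw [e']
    exact I.add_mem (I.add_mem (I.mul_mem_left _ h1) (I.mul_mem_left _ h2))
      (I.mul_mem_left _ (hr i j))
  have := taylor_two F (fun i => l * Polynomial.C (P i)) y I hcube
  have hg : ∀ i, eval P (pderiv i F) = 0 := fun i => congr_fun hgrad i
  simp only [← hp', aeval_C_mul_of_isHomogeneous hF, aeval_C_mul_of_isHomogeneous hF.pderiv,
    aeval_C_mul_of_isHomogeneous hF.pderiv.pderiv, hP, hg, map_zero, mul_zero, zero_mul,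
    Finset.sum_const_zero, sub_zero] at this
  have hsum : ∑ i, ∑ j, l ^ (n - 1 - 1) * Polynomial.C (eval P (pderiv i (pderiv j F))) * r i j
      ∈ I := I.sum_mem fun i _ => I.sum_mem fun j _ => I.mul_mem_left _ (hr i j)
  have h4 : ∑ i, ∑ j, l ^ (n - 1 - 1) * Polynomial.C (eval P (pderiv i (pderiv j F))) * (y i * y j)
      = l ^ (n - 1 - 1) *
      (ξ * ξ * Polynomial.C (∑ i, ∑ j, eval P (pderiv i (pderiv j F)) * (v i * v j))) +
      ∑ i, ∑ j, l ^ (n - 1 - 1) * Polynomial.C (eval P (pderiv i (pderiv j F))) * r i j := by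
    simp only [map_sum, Finset.mul_sum, ← Finset.sum_add_distrib]
    refine Finset.sum_congr rfl fun i _ => Finset.sum_congr rfl fun j _ => ?_
    rw [e, Polynomial.C_mul (a := eval P (pderiv i (pderiv j F)))]
    ring
  rw [h4, ← sub_sub] at this
  have h5 := I.add_mem this hsum
  rwa [sub_add_cancel] at h5

variable {t : ℂ} {N : ℕ} {G H : MvPolynomial (Fin 3) ℂ} {c n : ℕ}

theorem pow_dvd_of_pow_dvd_unit_mul {f g : Polynomial ℂ} (k : ℕ) (hg : g.eval t ≠ 0)
    (h : (Polynomial.X - Polynomial.C t) ^ k ∣ g * f) : (Polynomial.X - Polynomial.C t) ^ k ∣ f :=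
  (Polynomial.prime_X_sub_C t).pow_dvd_of_dvd_mul_left k
    (by rwa [Polynomial.dvd_iff_isRoot]) h

theorem hess_mulVec_apply (G : MvPolynomial (Fin 3) ℂ) (P v : Fin 3 → ℂ) (i : Fin 3) :
    (hess G P).mulVec v i = ∑ j, grad (pderiv i G) P j * v j := by
  simp only [Matrix.mulVec, dotProduct, hess, Matrix.of_apply, grad]
  exact Finset.sum_congr rfl fun j _ => by rw [pderiv_comm]

/-- Cramer's rule: some `2 × 2` minor of `a, b` is a nonzero constant, hence a unit among
polynomials. -/
theorem pow_dvd_of_independent {ξ η π : Polynomial ℂ} {a b : Fin 3 → ℂ}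
    (hli : LinearIndependent ℂ ![a, b])
    (h : ∀ i, π ∣ ξ * Polynomial.C (a i) + η * Polynomial.C (b i)) : π ∣ ξ ∧ π ∣ η := by
  have hne : ∃ i j, a i * b j - a j * b i ≠ 0 := by
    by_contra! hcon
    rw [LinearIndependent.pair_iff] at hli
    have hb : ∀ j, b j = 0 := fun j => by
      have := hli (b j) (-a j) (by
        ext i
        simp only [Pi.add_apply, Pi.smul_apply, smul_eq_mul, Pi.zero_apply]
        linear_combination hcon i j)
      exact this.1
    have := hli 0 1 (by ext i; simp [hb])
    exact one_ne_zero this.2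
  obtain ⟨i, j, hij⟩ := hne
  have hu : ∀ f : Polynomial ℂ, π ∣ Polynomial.C (a i * b j - a j * b i) * f → π ∣ f :=
    fun f hf => ((Polynomial.isUnit_C.mpr (isUnit_iff_ne_zero.mpr hij)).dvd_mul_left).mp hf
  constructor
  · apply hu
    have := dvd_sub ((h i).mul_left (Polynomial.C (b j))) ((h j).mul_left (Polynomial.C (b i)))
    convert! this using 1
    simp only [map_sub, map_mul]
    ring
  · apply hu
    have := dvd_sub ((h j).mul_left (Polynomial.C (a i))) ((h i).mul_left (Polynomial.C (a j)))
    convert! this using 1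
    simp only [map_sub, map_mul]
    ring

/-- At a node the partial derivatives generate the maximal ideal. Bootstrapping on `k`: once `π ^ k`
divides `ξ` and `η`, their products vanish modulo `π ^ (k + 1)`, so the gradient reduces to its
Hessian part. Independence of the two Hessian images then passes divisibility by `π ^ (k + 1)` to
`ξ` and `η`. -/
theorem node_arc_dvd (hG : G.IsHomogeneous c) (hH : H.IsHomogeneous n)
    (hp : ∀ i, p i = l * Polynomial.C (P i) + (ξ * Polynomial.C (v i) + η * Polynomial.C (w i)))
    (hl : l.eval t ≠ 0) (hξ : Polynomial.X - Polynomial.C t ∣ ξ)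
    (hη : Polynomial.X - Polynomial.C t ∣ η)
    (hgrad : grad G P = 0)
    (hli : LinearIndependent ℂ ![(hess G P).mulVec v, (hess G P).mulVec w])
    (hN : ∀ i, (Polynomial.X - Polynomial.C t) ^ N ∣ aeval p (pderiv i G))
    (hHP : eval P H = 0) : (Polynomial.X - Polynomial.C t) ^ N ∣ aeval p H := by
  set π := Polynomial.X - Polynomial.C t with hπ
  have key : ∀ k ≤ N, π ^ k ∣ ξ ∧ π ^ k ∣ η := by
    intro k
    induction k with
    | zero => simp
    | succ k ih =>
      intro hk
      obtain ⟨h1, h2⟩ := ih (by omega)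
      apply pow_dvd_of_independent hli
      intro i
      have := arc_expansion_one (hG.pderiv (i := i)) hp (Ideal.span {π ^ (k + 1)})
        (by rw [Ideal.mem_span_singleton, pow_succ]; exact mul_dvd_mul h1 hξ)
        (by rw [Ideal.mem_span_singleton, pow_succ]; exact mul_dvd_mul h1 hη)
        (by rw [Ideal.mem_span_singleton, pow_succ]; exact mul_dvd_mul h2 hη)
      rw [Ideal.mem_span_singleton, dvd_sub_right ((pow_dvd_pow _ hk).trans (hN i)),
        show eval P (pderiv i G) = 0 from congr_fun hgrad i, map_zero, mul_zero, zero_add,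
        ← hess_mulVec_apply, ← hess_mulVec_apply] at this
      exact pow_dvd_of_pow_dvd_unit_mul _ (by rw [Polynomial.eval_pow]; exact pow_ne_zero _ hl) this
  obtain ⟨h1, h2⟩ := key N le_rfl
  have := arc_expansion_one hH hp (Ideal.span {π ^ N})
    (by rw [Ideal.mem_span_singleton]; exact h1.mul_right _)
    (by rw [Ideal.mem_span_singleton]; exact h1.mul_right _)
    (by rw [Ideal.mem_span_singleton]; exact h2.mul_right _)
  rw [Ideal.mem_span_singleton, hHP, map_zero, mul_zero, zero_add] at this
  refine (dvd_sub_left ?_).mp this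
  exact (dvd_add (h1.mul_right _) (h2.mul_right _)).mul_left _

/-- At a cusp the Jacobian ideal is `(x², y)`. The derivative `F` of `G` along the cuspidal tangent
`v` has leading term a multiple of `ξ²`, by the nonzero third derivative. A partial derivative not
killed by `w` in the Hessian has leading term a multiple of `η`. Divisibility of `ξ²` and `η` is
bootstrapped jointly. -/
theorem cusp_arc_dvd (hG : G.IsHomogeneous c) (hH : H.IsHomogeneous n)
    (hp : ∀ i, p i = l * Polynomial.C (P i) + (ξ * Polynomial.C (v i) + η * Polynomial.C (w i)))
    (hl : l.eval t ≠ 0) (hξ : Polynomial.X - Polynomial.C t ∣ ξ)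
    (hη : Polynomial.X - Polynomial.C t ∣ η)
    (hgrad : grad G P = 0) (hv : (hess G P).mulVec v = 0) (hw : (hess G P).mulVec w ≠ 0)
    (hv3 : thirdDeriv G P v ≠ 0)
    (hN : ∀ i, (Polynomial.X - Polynomial.C t) ^ N ∣ aeval p (pderiv i G))
    (hHP : eval P H = 0) (hHv : ∑ i, grad H P i * v i = 0) :
    (Polynomial.X - Polynomial.C t) ^ N ∣ aeval p H := by
  set π := Polynomial.X - Polynomial.C t with hπ
  obtain ⟨i₀, hi₀⟩ := Function.ne_iff.mp hw
  set F : MvPolynomial (Fin 3) ℂ := ∑ k, C (v k) * pderiv k G with hFdef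
  have hF : F.IsHomogeneous (c - 1) := IsHomogeneous.sum _ _ _ fun k _ => hG.pderiv.C_mul _
  have hFP : eval P F = 0 := by
    rw [hFdef, map_sum]
    refine Finset.sum_eq_zero fun k _ => ?_
    rw [map_mul, show eval P (pderiv k G) = 0 from congr_fun hgrad k, mul_zero]
  have hFgrad : grad F P = 0 := by
    ext i
    have := congr_fun hv i
    simp only [Matrix.mulVec, dotProduct, hess, Matrix.of_apply, Pi.zero_apply] at this
    simp only [grad, hFdef, map_sum, pderiv_C_mul, map_mul, eval_C, Pi.zero_apply]
    rw [← this]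
    exact Finset.sum_congr rfl fun k _ => by ring
  have hF2 : ∑ i, ∑ j, eval P (pderiv i (pderiv j F)) * (v i * v j) = thirdDeriv G P v := by
    simp only [hFdef, thirdDeriv, map_sum, pderiv_C_mul, map_mul, eval_C, Finset.sum_mul]
    refine Finset.sum_congr rfl fun i _ => Finset.sum_congr rfl fun j _ =>
      Finset.sum_congr rfl fun k _ => by ring
  have hFN : π ^ N ∣ aeval p F := by
    rw [hFdef, map_sum]
    refine Finset.dvd_sum fun k _ => ?_
    rw [map_mul]
    exact (hN k).mul_left _
  have key : ∀ k ≤ N, π ^ k ∣ ξ * ξ ∧ π ^ k ∣ η := by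
    intro k
    induction k with
    | zero => simp
    | succ k ih =>
      intro hk
      obtain ⟨h1, h2⟩ := ih (by omega)
      have m2 : ξ * η ∈ Ideal.span {π ^ (k + 1)} := by
        rw [Ideal.mem_span_singleton, pow_succ, mul_comm ξ]
        exact mul_dvd_mul h2 hξ
      have m3 : η * η ∈ Ideal.span {π ^ (k + 1)} := by
        rw [Ideal.mem_span_singleton, pow_succ]
        exact mul_dvd_mul h2 hη
      -- The bound on `ξ²` must come first: the linear expansion that yields `η` needs `ξ²` to
      -- vanish modulo `π ^ (k + 1)`.
      have hξ2 : π ^ (k + 1) ∣ ξ * ξ := by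
        have := arc_expansion_two hF hp hFP hFgrad (Ideal.span {π ^ (k + 1)})
          (by rw [Ideal.mem_span_singleton, pow_succ]; exact mul_dvd_mul h1 hξ) m2 m3
        rw [Ideal.mem_span_singleton,
          dvd_sub_right (((pow_dvd_pow _ hk).trans hFN).mul_left _), hF2] at this
        have := pow_dvd_of_pow_dvd_unit_mul _
          (by rw [Polynomial.eval_pow]; exact pow_ne_zero _ hl) this
        rw [mul_comm] at this
        exact pow_dvd_of_pow_dvd_unit_mul _ (by rwa [Polynomial.eval_C]) this
      refine ⟨hξ2, ?_⟩
      have := arc_expansion_one (hG.pderiv (i := i₀)) hp (Ideal.span {π ^ (k + 1)})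
        (by rwa [Ideal.mem_span_singleton]) m2 m3
      rw [Ideal.mem_span_singleton, dvd_sub_right ((pow_dvd_pow _ hk).trans (hN i₀)),
        show eval P (pderiv i₀ G) = 0 from congr_fun hgrad i₀, map_zero, mul_zero, zero_add,
        ← hess_mulVec_apply, ← hess_mulVec_apply, hv, Pi.zero_apply, map_zero, mul_zero,
        zero_add] at this
      have := pow_dvd_of_pow_dvd_unit_mul _
        (by rw [Polynomial.eval_pow]; exact pow_ne_zero _ hl) this
      rw [mul_comm] at this
      exact pow_dvd_of_pow_dvd_unit_mul _ (by rwa [Polynomial.eval_C]) this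
  obtain ⟨h1, h2⟩ := key N le_rfl
  have := arc_expansion_one hH hp (Ideal.span {π ^ N})
    (by rwa [Ideal.mem_span_singleton])
    (by rw [Ideal.mem_span_singleton]; exact h2.mul_left _)
    (by rw [Ideal.mem_span_singleton]; exact h2.mul_right _)
  rw [Ideal.mem_span_singleton, hHP, hHv, map_zero, mul_zero, mul_zero, zero_add, zero_add] at this
  exact (dvd_sub_left ((h2.mul_right _).mul_left _)).mp this

end Arc

/-- The coordinates of a polynomial arc with respect to a basis of the ambient space. -/
theorem exists_arc_coordinates (p : Fin 3 → Polynomial ℂ) (t : ℂ) {v w : Fin 3 → ℂ}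
    (hli : LinearIndependent ℂ ![fun i => (p i).eval t, v, w]) :
    ∃ l ξ η : Polynomial ℂ, l.eval t ≠ 0 ∧ Polynomial.X - Polynomial.C t ∣ ξ ∧
      Polynomial.X - Polynomial.C t ∣ η ∧
      ∀ i, p i = l * Polynomial.C ((p i).eval t) +
        (ξ * Polynomial.C (v i) + η * Polynomial.C (w i)) := by
  set b := basisOfLinearIndependentOfCardEqFinrank hli (by simp) with hb
  have hbk : ∀ k, b k = ![fun i => (p i).eval t, v, w] k := fun k => by
    rw [hb, coe_basisOfLinearIndependentOfCardEqFinrank]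
  set q : Fin 3 → Polynomial ℂ := fun k => ∑ j, Polynomial.C (b.repr (Pi.single j 1) k) * p j
    with hq
  have hqt : ∀ k, (q k).eval t = b.repr (fun i => (p i).eval t) k := fun k => by
    have e : (fun i => (p i).eval t) = ∑ j, (p j).eval t • (Pi.single j 1 : Fin 3 → ℂ) :=
      pi_eq_sum_univ' _
    rw [e, map_sum, Finsupp.finsetSum_apply, hq, Polynomial.eval_finsetSum]
    refine Finset.sum_congr rfl fun j _ => ?_
    simp [mul_comm]
  have h0 : b.repr (fun i => (p i).eval t) = Finsupp.single 0 1 := by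
    rw [← b.repr_self 0, hbk]
    rfl
  rw [h0] at hqt
  refine ⟨q 0, q 1, q 2, ?_, ?_, ?_, ?_⟩
  · rw [hqt]; simp
  · rw [Polynomial.dvd_iff_isRoot, Polynomial.IsRoot, hqt]; simp
  · rw [Polynomial.dvd_iff_isRoot, Polynomial.IsRoot, hqt]; simp
  · intro i
    have e : ∑ k, q k * Polynomial.C (b k i) = p i := by
      have : ∀ j, ∑ k, b.repr (Pi.single j 1) k * b k i = (Pi.single j 1 : Fin 3 → ℂ) i := fun j => by
        have := congr_fun (b.sum_repr (Pi.single j 1)) i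
        rw [← this]
        simp
      simp only [hq, Finset.sum_mul]
      rw [Finset.sum_comm]
      have e2 : ∀ j, ∑ k, Polynomial.C (b.repr (Pi.single j 1) k) * p j * Polynomial.C (b k i)
          = Polynomial.C ((Pi.single j 1 : Fin 3 → ℂ) i) * p j := fun j => by
        rw [← this j, map_sum, Finset.sum_mul]
        refine Finset.sum_congr rfl fun k _ => ?_
        rw [Polynomial.C_mul]; ring
      simp only [e2]
      rw [Finset.sum_eq_single i]
      · simp
      · intro j _ hj
        simp [hj.symm]
      · simp
    conv_lhs => rw [← e]
    rw [Fin.sum_univ_three, hbk, hbk, hbk]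
    simp [add_assoc]

/-! ### Euler's relation at singular points -/

theorem euler_eval {G : MvPolynomial (Fin 3) ℂ} {c : ℕ} (hG : G.IsHomogeneous c)
    (P : Fin 3 → ℂ) : ∑ i, grad G P i * P i = c * eval P G := by
  have := congrArg (eval P) hG.sum_X_mul_pderiv
  simp only [map_sum, map_mul, eval_X, nsmul_eq_mul, map_natCast] at this
  rw [← this]
  exact Finset.sum_congr rfl fun i _ => mul_comm _ _

theorem hess_mulVec_self {G : MvPolynomial (Fin 3) ℂ} {c : ℕ} (hG : G.IsHomogeneous c)
    {P : Fin 3 → ℂ} (h : grad G P = 0) : (hess G P).mulVec P = 0 := by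
  ext i
  rw [hess_mulVec_apply, euler_eval hG.pderiv, show eval P (pderiv i G) = 0 from congr_fun h i,
    mul_zero, Pi.zero_apply]

/-- Euler's relation, applied twice, reduces this to the Hessian killing `P`. It shows that a
cuspidal direction with nonzero cubic term is not a multiple of `P`. -/
theorem thirdDeriv_smul_self {G : MvPolynomial (Fin 3) ℂ} {c : ℕ} (hG : G.IsHomogeneous c)
    {P : Fin 3 → ℂ} (h : grad G P = 0) (r : ℂ) : thirdDeriv G P (r • P) = 0 := by
  have e : thirdDeriv G P (r • P) =
      r ^ 3 * ∑ k, ∑ j, (∑ i, grad (pderiv j (pderiv k G)) P i * P i) * (P j * P k) := by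
    simp only [thirdDeriv, Pi.smul_apply, smul_eq_mul, Finset.mul_sum, Finset.sum_mul, grad]
    rw [Finset.sum_comm]
    rw [Finset.sum_comm' (t' := Finset.univ) (s' := fun _ => Finset.univ) (by simp)]
    simp only [Fin.sum_univ_three]
    ring
  rw [e]
  have e2 : ∀ k, ∑ j, grad (pderiv k G) P j * P j = 0 := fun k => by
    rw [← hess_mulVec_apply, hess_mulVec_self hG h, Pi.zero_apply]
  have e3 : ∀ k, ∑ j, (∑ i, grad (pderiv j (pderiv k G)) P i * P i) * (P j * P k) =
      ((c - 1 - 1 : ℕ) : ℂ) * P k * ∑ j, grad (pderiv k G) P j * P j := fun k => by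
    rw [Finset.mul_sum]
    refine Finset.sum_congr rfl fun j _ => ?_
    rw [euler_eval hG.pderiv.pderiv]
    simp only [grad]
    ring
  simp [e3, e2]

theorem exists_linearIndependent_triple {P v : Fin 3 → ℂ} (h : LinearIndependent ℂ ![P, v]) :
    ∃ w, LinearIndependent ℂ ![P, v, w] := by
  obtain ⟨w, hw⟩ := exists_linearIndependent_cons_of_lt_finrank h (by simp)
  refine ⟨w, ?_⟩
  have := hw.comp ![1, 2, 0] (by decide)
  convert! this using 1
  ext i
  fin_cases i <;> rfl

/-- A section of the ideal of the equiclassical scheme vanishes along an arc on the curve at least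
to the order of the gradient. -/
theorem equiclassical_arc_dvd {G H : MvPolynomial (Fin 3) ℂ} {c n N : ℕ} {t : ℂ}
    {p : Fin 3 → Polynomial ℂ} (hG : G.IsHomogeneous c) (hH : H.IsHomogeneous n)
    (hnc : IsNodalCuspidal G) (hI : InEquiclassicalIdeal G H)
    (hP : (fun i => (p i).eval t) ≠ 0) (hGP : eval (fun i => (p i).eval t) G = 0)
    (hN : ∀ i, (Polynomial.X - Polynomial.C t) ^ N ∣ aeval p (pderiv i G)) :
    (Polynomial.X - Polynomial.C t) ^ N ∣ aeval p H := by
  rcases Nat.eq_zero_or_pos N with rfl | hNpos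
  · simp
  -- Since `N > 0`, the gradient vanishes at the point, which is therefore singular.
  have hgrad : grad G (fun i => (p i).eval t) = 0 := by
    ext i
    have := (dvd_pow_self _ hNpos.ne').trans (hN i)
    rw [Polynomial.dvd_iff_isRoot, Polynomial.IsRoot, polynomial_eval_aeval] at this
    exact this
  obtain ⟨P, hPdef⟩ : ∃ P : Fin 3 → ℂ, P = fun i => (p i).eval t := ⟨_, rfl⟩
  have harc := fun v w => exists_arc_coordinates p t (v := v) (w := w)
  rw [← hPdef] at hP hGP hgrad harc
  simp only [show ∀ i, (p i).eval t = P i from fun i => (congr_fun hPdef i).symm] at harc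
  have hHP := hess_mulVec_self hG hgrad
  have hrk := LinearMap.finrank_range_add_finrank_ker (hess G P).mulVecLin
  rw [Module.finrank_fin_fun, ← Matrix.rank] at hrk
  rcases hnc P ⟨hP, hGP, hgrad⟩ with hnode | hcusp
  · obtain ⟨v, hv⟩ := exists_linearIndependent_cons_of_lt_finrank
      (v := ![P]) (LinearIndependent.of_subsingleton 0 hP)
      (by simp : 1 < Module.finrank ℂ (Fin 3 → ℂ))
    have hPv : LinearIndependent ℂ ![P, v] := LinearIndependent.pair_symm_iff.mp hv
    obtain ⟨w, hw⟩ := exists_linearIndependent_triple hPv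
    obtain ⟨l, ξ, η, hl, hξ, hη, hp⟩ := harc v w hw
    refine node_arc_dvd hG hH hp hl hξ hη hgrad ?_ hN (hI.1 P hnode)
    rw [LinearIndependent.pair_iff]
    intro a b hab
    rw [hnode.2] at hrk
    have hker : Module.finrank ℂ (LinearMap.ker (hess G P).mulVecLin) = 1 := by omega
    -- At a node the Hessian kernel is the line of `P`, so a relation between the images of `v` and
    -- `w` is a relation between `P`, `v` and `w`.
    obtain ⟨r, hr⟩ := (finrank_eq_one_iff_of_nonzero'
      (⟨P, by simpa using hHP⟩ : LinearMap.ker (hess G P).mulVecLin)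
      (fun h => hP (congrArg Subtype.val h))).mp hker ⟨a • v + b • w, by
        simpa [Matrix.mulVec_add, Matrix.mulVec_smul] using hab⟩
    have hr' : r • P = a • v + b • w := congrArg Subtype.val hr
    have h3 := Fintype.linearIndependent_iff.mp hw ![-r, a, b] (by
      simp [Fin.sum_univ_three, hr', add_assoc])
    exact ⟨h3 1, h3 2⟩
  · obtain ⟨v, hv, hv3⟩ := hcusp.2.2
    have hPv : LinearIndependent ℂ ![P, v] := by
      rw [LinearIndependent.pair_iff' hP]
      rintro r rfl
      exact hv3 (thirdDeriv_smul_self hG hgrad r)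
    obtain ⟨w, hw⟩ := exists_linearIndependent_triple hPv
    obtain ⟨l, ξ, η, hl, hξ, hη, hp⟩ := harc v w hw
    refine cusp_arc_dvd hG hH hp hl hξ hη hgrad hv ?_ hv3 hN (hI.2 P hcusp).1
      ((hI.2 P hcusp).2 v hv)
    -- Otherwise the independent vectors `P`, `v`, `w` would all lie in the Hessian kernel, which is
    -- a plane at a cusp.
    intro hw0
    rw [hcusp.2.1] at hrk
    have hli : LinearIndependent ℂ (![⟨P, by simpa using hHP⟩, ⟨v, by simpa using hv⟩,
        ⟨w, by simpa using hw0⟩] : Fin 3 → LinearMap.ker (hess G P).mulVecLin) := by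
      apply LinearIndependent.of_comp (LinearMap.ker (hess G P).mulVecLin).subtype
      convert! hw using 1
      ext i
      fin_cases i <;> rfl
    have := hli.fintype_card_le_finrank
    simp at this
    omega

theorem dvd_of_forall_pow_dvd {A f : Polynomial ℂ} (hA : A ≠ 0)
    (h : ∀ t N, (Polynomial.X - Polynomial.C t) ^ N ∣ A → (Polynomial.X - Polynomial.C t) ^ N ∣ f) :
    A ∣ f := by
  classical
  rcases eq_or_ne f 0 with rfl | hf
  · simp
  rw [IsAlgClosed.dvd_iff_roots_le_roots hA hf, Multiset.le_iff_count]
  intro t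
  rw [Polynomial.count_roots, Polynomial.count_roots, Polynomial.le_rootMultiplicity_iff hf]
  exact h t _ (Polynomial.pow_rootMultiplicity_dvd A t)

/-! ### General lines -/

theorem exists_eval_ne_zero {σ : Type*} {R : MvPolynomial σ ℂ} (hR : R ≠ 0) :
    ∃ q, eval q R ≠ 0 := by
  by_contra! h
  exact hR (MvPolynomial.funext fun q => by rw [h q, map_zero])

/-- The linear form with coefficient vector `a`. -/
def linearForm (a : Fin 3 → ℂ) : MvPolynomial (Fin 3) ℂ := ∑ i, C (a i) * X i

theorem eval_linearForm (a q : Fin 3 → ℂ) : eval q (linearForm a) = ∑ i, q i * a i := by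
  simp [linearForm, mul_comm]

theorem linearForm_ne_zero {a : Fin 3 → ℂ} (ha : a ≠ 0) : linearForm a ≠ 0 := by
  obtain ⟨i, hi⟩ := Function.ne_iff.mp ha
  intro h
  have := eval_linearForm a (Pi.single i 1)
  rw [h, map_zero, Finset.sum_eq_single i (by intro j _ hj; simp [hj]) (by simp)] at this
  simp at this
  exact hi this.symm

theorem roots_nodup_of_no_double_root {f : Polynomial ℂ} (hf : f ≠ 0)
    (h : ∀ s, f.IsRoot s → ¬ f.derivative.IsRoot s) : f.roots.Nodup := by
  classical
  rw [Multiset.nodup_iff_count_le_one]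
  intro s
  rw [Polynomial.count_roots]
  by_contra! hc
  rw [Polynomial.one_lt_rootMultiplicity_iff_isRoot hf] at hc
  exact h s hc.1 hc.2

/-- A general linear combination of polynomials without common zero has only simple zeros. -/
theorem exists_general_section (ψ : Fin 3 → Polynomial ℂ) (D : ℕ)
    (hdeg : ∀ i, (ψ i).natDegree ≤ D) (hD : (fun i => (ψ i).coeff D) ≠ 0)
    (hcop : ∀ t, (fun i => (ψ i).eval t) ≠ 0) {b : Polynomial ℂ} (hb : b ≠ 0)
    {R : MvPolynomial (Fin 3) ℂ} (hR : R ≠ 0) :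
    ∃ q, eval q R ≠ 0 ∧ ∃ Z : Finset ℂ, Z.card = D ∧
      ∀ z ∈ Z, b.eval z ≠ 0 ∧ ∑ i, q i * (ψ i).eval z = 0 := by
  classical
  -- The second factor prevents a drop of degree, and the third keeps the zeros of the section away
  -- from those of `b`.
  set R' := R * linearForm (fun i => (ψ i).coeff D) *
    ∏ z ∈ b.roots.toFinset, linearForm (fun i => (ψ i).eval z) with hR'
  have hR'0 : R' ≠ 0 := mul_ne_zero (mul_ne_zero hR (linearForm_ne_zero hD))
    (Finset.prod_ne_zero_iff.mpr fun z _ => linearForm_ne_zero (hcop z))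
  set S : (Fin 3 → ℂ) → Polynomial ℂ := fun q => ∑ i, Polynomial.C (q i) * ψ i with hS
  have hSe : ∀ q z, (S q).eval z = ∑ i, q i * (ψ i).eval z := fun q z => by
    simp [hS, Polynomial.eval_finsetSum]
  have hSc : ∀ q, (S q).coeff D = ∑ i, q i * (ψ i).coeff D := fun q => by
    simp [hS, Polynomial.finsetSum_coeff]
  have hSd : ∀ q, (S q).natDegree ≤ D := fun q =>
    Polynomial.natDegree_sum_le_of_forall_le _ _ fun i _ =>
      (Polynomial.natDegree_C_mul_le _ _).trans (hdeg i)
  have hgood : ∀ q, eval q R' ≠ 0 → eval q R ≠ 0 ∧ S q ≠ 0 ∧ (S q).natDegree = D ∧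
      ∀ z, (S q).IsRoot z → b.eval z ≠ 0 := fun q hq => by
    rw [hR', map_mul, map_mul, mul_ne_zero_iff, mul_ne_zero_iff, eval_linearForm, map_prod,
      Finset.prod_ne_zero_iff, ← hSc] at hq
    refine ⟨hq.1.1, fun h => hq.1.2 (by rw [h, Polynomial.coeff_zero]),
      le_antisymm (hSd q) (Polynomial.le_natDegree_of_ne_zero hq.1.2), fun z hz hbz => ?_⟩
    apply hq.2 z (by simpa [hb] using hbz)
    rw [eval_linearForm, ← hSe]
    exact hz
  have hfinish : ∀ q, eval q R' ≠ 0 → (S q).roots.Nodup →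
      ∃ q, eval q R ≠ 0 ∧ ∃ Z : Finset ℂ, Z.card = D ∧
        ∀ z ∈ Z, b.eval z ≠ 0 ∧ ∑ i, q i * (ψ i).eval z = 0 := fun q hq hn => by
    obtain ⟨h1, h2, h3, h4⟩ := hgood q hq
    refine ⟨q, h1, (S q).roots.toFinset, ?_, fun z hz => ?_⟩
    · rw [Multiset.toFinset_card_of_nodup hn, ← h3]
      exact IsAlgClosed.card_roots_eq_natDegree
    · have hz' : (S q).IsRoot z := by simpa [h2] using hz
      exact ⟨h4 z hz', by rw [← hSe]; exact hz'⟩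
  obtain ⟨q₀, hq₀⟩ := exists_eval_ne_zero hR'0
  obtain ⟨h1, h2, h3, h4⟩ := hgood q₀ hq₀
  obtain ⟨q₁, hq₁⟩ := exists_eval_ne_zero (R := ∏ z ∈ (S q₀).roots.toFinset,
    linearForm (fun i => (ψ i).eval z))
    (Finset.prod_ne_zero_iff.mpr fun z _ => linearForm_ne_zero (hcop z))
  rw [map_prod, Finset.prod_ne_zero_iff] at hq₁
  have hcommon : ∀ z, (S q₀).IsRoot z → (S q₁).eval z ≠ 0 := fun z hz => by
    have := hq₁ z (by simpa [h2] using hz)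
    rwa [eval_linearForm, ← hSe] at this
  -- A Bertini argument in the pencil `S q₀ + x S q₁` without base points: a double zero of a member
  -- is a zero of the Wronskian. If the Wronskian vanishes identically, coprimality in
  -- characteristic zero makes `S q₀` constant.
  by_cases hW : Polynomial.wronskian (S q₀) (S q₁) = 0
  · have hc : IsCoprime (S q₀) (S q₁) :=
      isCoprime_of_irreducible_dvd (fun h => h2 h.1) fun z hz h₀ h₁ => by
        obtain ⟨s, hs⟩ := IsAlgClosed.exists_root z (Polynomial.degree_pos_of_irreducible hz).ne'
        exact hcommon s (hs.dvd h₀) (hs.dvd h₁)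
    have hder := (hc.wronskian_eq_zero_iff.mp hW).1
    have h0 := Polynomial.derivative_eq_zero.mp hder
    refine hfinish q₀ hq₀ (roots_nodup_of_no_double_root h2 fun s hs => ?_)
    rw [Polynomial.eq_C_of_natDegree_eq_zero h0] at hs h2
    simp at hs
    rw [hs] at h2
    simp at h2
  · set r : Polynomial ℂ := aeval (fun i => Polynomial.C (q₀ i) + Polynomial.X * Polynomial.C (q₁ i))
      R' with hr
    have hre : ∀ x, r.eval x = eval (q₀ + x • q₁) R' := fun x => by
      rw [hr, polynomial_eval_aeval]
      congr 1
      congr 1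
      ext i
      simp
      ring
    have hr0 : r ≠ 0 := fun h => hq₀ (by simpa [h] using (hre 0).symm)
    -- Each zero `s` of the Wronskian lies on just one member of the pencil, `x = -S q₀(s) / S
    -- q₁(s)`, unless `S q₁(s) = 0`. So finitely many `x` are excluded.
    obtain ⟨x, hx⟩ := Infinite.exists_notMem_finset (r.roots.toFinset ∪
      (Polynomial.wronskian (S q₀) (S q₁)).roots.toFinset.image
        (fun s => - (S q₀).eval s / (S q₁).eval s))
    rw [Finset.mem_union, not_or] at hx
    have hxr : eval (q₀ + x • q₁) R' ≠ 0 := by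
      rw [← hre]
      intro h
      exact hx.1 (by simpa [hr0] using h)
    have hSx : S (q₀ + x • q₁) = S q₀ + Polynomial.C x * S q₁ := by
      simp only [hS, Pi.add_apply, Pi.smul_apply, smul_eq_mul, map_add, map_mul, add_mul,
        Finset.sum_add_distrib, Finset.mul_sum, mul_assoc]
    refine hfinish _ hxr (roots_nodup_of_no_double_root (hgood _ hxr).2.1 fun s hs hs' => ?_)
    rw [hSx] at hs hs'
    simp only [Polynomial.IsRoot, Polynomial.derivative_add, Polynomial.derivative_C_mul,
      Polynomial.eval_add, Polynomial.eval_mul, Polynomial.eval_C] at hs hs'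
    have hg : (S q₁).eval s ≠ 0 := fun h => by
      rw [h, mul_zero, add_zero] at hs
      exact hcommon s hs h
    apply hx.2
    rw [Finset.mem_image]
    refine ⟨s, ?_, ?_⟩
    · rw [Multiset.mem_toFinset, Polynomial.mem_roots hW, Polynomial.IsRoot, Polynomial.wronskian]
      simp only [Polynomial.eval_sub, Polynomial.eval_mul]
      linear_combination (S q₁).derivative.eval s * hs - (S q₁).eval s * hs'
    · rw [div_eq_iff hg]
      linear_combination -hs

/-- A form vanishing at more points of a line than its degree vanishes on the line. -/
theorem eval_eq_zero_of_line {F : MvPolynomial (Fin 3) ℂ} {n : ℕ} (hF : F.IsHomogeneous n)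
    {q : Fin 3 → ℂ} (hq : q ≠ 0) {ι : Type*} (Z : Finset ι) (x : ι → Fin 3 → ℂ)
    (hx0 : ∀ z ∈ Z, x z ≠ 0) (hxq : ∀ z ∈ Z, ∑ i, q i * x z i = 0)
    (hxF : ∀ z ∈ Z, eval (x z) F = 0)
    (hinj : ∀ z ∈ Z, ∀ z' ∈ Z, ∀ r : ℂ, x z' = r • x z → z' = z) (hcard : n < Z.card)
    {y : Fin 3 → ℂ} (hy : ∑ i, q i * y i = 0) : eval y F = 0 := by
  classical
  by_contra hFy
  obtain ⟨z₀, hz₀⟩ := Finset.card_pos.mp (by omega : 0 < Z.card)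
  have hli : LinearIndependent ℂ ![x z₀, y] := by
    rw [LinearIndependent.pair_iff]
    intro s t hst
    have h1 : t ^ n * eval y F = 0 := by
      rw [← eval_smul_of_isHomogeneous hF, show t • y = (-s) • x z₀ by
        rw [neg_smul]; exact eq_neg_of_add_eq_zero_right hst, eval_smul_of_isHomogeneous hF,
        hxF z₀ hz₀, mul_zero]
    have ht : t = 0 := by
      by_contra ht
      exact mul_ne_zero (pow_ne_zero n ht) hFy h1
    rw [ht, zero_smul, add_zero] at hst
    exact ⟨(smul_eq_zero.mp hst).resolve_right (hx0 z₀ hz₀), ht⟩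
  have hspan : ∀ u : Fin 3 → ℂ, ∑ i, q i * u i = 0 → ∃ a b : ℂ, a • x z₀ + b • y = u := by
    intro u hu
    rw [← Submodule.mem_span_pair]
    by_contra hnot
    have h3 : LinearIndependent ℂ (Fin.cons u ![x z₀, y] : Fin 3 → Fin 3 → ℂ) :=
      linearIndependent_finCons.mpr ⟨hli, by
        rwa [show Set.range ![x z₀, y] = {x z₀, y} by simp [Set.pair_comm]]⟩
    have htop := h3.span_eq_top_of_card_eq_finrank (by simp)
    have hlc : ∀ u, Fintype.linearCombination ℂ q u = ∑ i, q i * u i := fun u => by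
      simp [Fintype.linearCombination_apply, mul_comm]
    have hle : (⊤ : Submodule ℂ (Fin 3 → ℂ)) ≤
        LinearMap.ker (Fintype.linearCombination ℂ q) := by
      rw [← htop, Submodule.span_le]
      rintro _ ⟨k, rfl⟩
      fin_cases k
      · exact (hlc _).trans hu
      · exact (hlc _).trans (hxq z₀ hz₀)
      · exact (hlc _).trans hy
    apply hq
    ext i
    have := hle (Submodule.mem_top (x := Pi.single i 1))
    simpa [hlc, Pi.single_apply] using this
  set f : Polynomial ℂ := aeval (fun i => Polynomial.C (x z₀ i) * Polynomial.X + Polynomial.C (y i)) F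
    with hf
  have hfe : ∀ s, f.eval s = eval (s • x z₀ + y) F := fun s => by
    rw [hf, polynomial_eval_aeval]
    congr 1
    congr 1
    ext i
    simp
    ring
  have hf0 : f ≠ 0 := fun h => hFy (by simpa [h] using (hfe 0).symm)
  have hdeg := aeval_natDegree_coeff hF
    (fun i => Polynomial.C (x z₀ i) * Polynomial.X + Polynomial.C (y i)) 1
    (fun i => Polynomial.natDegree_linear_le)
  rw [mul_one, ← hf] at hdeg
  -- The point `x z₀` is at infinity in this affine chart of the line. Vanishing of `F` there lowers
  -- the degree of `f` by one, and the other points are finite roots.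
  have hcoef : f.coeff n = 0 := by
    rw [hdeg.2, ← hxF z₀ hz₀]
    congr 1
    congr 1
    ext i
    simp
  have hlt : f.natDegree < n := lt_of_le_of_ne hdeg.1 fun h => hf0 (by
    rwa [← h, Polynomial.coeff_natDegree, Polynomial.leadingCoeff_eq_zero] at hcoef)
  have hex : ∀ z : Z.erase z₀, ∃ s : ℂ, f.IsRoot s ∧ ∃ b : ℂ, b ≠ 0 ∧ x z = b • (s • x z₀ + y) := by
    rintro ⟨z, hz⟩
    obtain ⟨hzne, hzZ⟩ := Finset.mem_erase.mp hz
    obtain ⟨a, b, hab⟩ := hspan (x z) (hxq z hzZ)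
    have hb : b ≠ 0 := by
      rintro rfl
      rw [zero_smul, add_zero] at hab
      exact hzne (hinj z₀ hz₀ z hzZ a hab.symm)
    have e : x z = b • ((a / b) • x z₀ + y) := by
      rw [smul_add, smul_smul, mul_div_cancel₀ _ hb, hab]
    refine ⟨a / b, ?_, b, hb, e⟩
    have := hxF z hzZ
    rw [e, eval_smul_of_isHomogeneous hF, ← hfe] at this
    exact (mul_eq_zero.mp this).resolve_left (pow_ne_zero _ hb)
  choose s hs b hb hsb using hex
  have hsinj : Function.Injective s := fun z z' h => by
    apply Subtype.ext
    refine hinj z' (Finset.mem_of_mem_erase z'.2) z (Finset.mem_of_mem_erase z.2) (b z / b z') ?_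
    rw [hsb z, hsb z', h, smul_smul, div_mul_cancel₀ _ (hb z')]
  have hle : (Finset.univ.image s).card ≤ f.roots.toFinset.card :=
    Finset.card_le_card fun r hr => by
      obtain ⟨z, _, rfl⟩ := Finset.mem_image.mp hr
      simpa [hf0] using hs z
  rw [Finset.card_image_of_injective _ hsinj, Finset.card_univ, Fintype.card_coe,
    Finset.card_erase_of_mem hz₀] at hle
  have := (Multiset.toFinset_card_le f.roots).trans (Polynomial.card_roots' f)
  omega

/-! ### Affine parametrizations of rational curves -/

/-- An affine parametrization of degree `c` of the curve `G = 0`, birational onto its image and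
without base points. -/
structure IsParametrization (c : ℕ) (G : MvPolynomial (Fin 3) ℂ) (p : Fin 3 → Polynomial ℂ) :
    Prop where
  natDegree_le : ∀ i, (p i).natDegree ≤ c
  coeff_ne_zero : (fun i => (p i).coeff c) ≠ 0
  eval_ne_zero : ∀ t, (fun i => (p i).eval t) ≠ 0
  aeval_eq_zero : aeval p G = 0
  generically_injective : ∃ b : Polynomial ℂ, b ≠ 0 ∧ ∀ s t r : ℂ, b.eval s ≠ 0 →
    (fun i => (p i).eval t) = r • (fun i => (p i).eval s) → t = s

theorem eval_aeval {σ τ : Type*} (φ : σ → MvPolynomial τ ℂ) (F : MvPolynomial σ ℂ) (x : τ → ℂ) :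
    eval x (aeval φ F) = eval (fun i => eval x (φ i)) F := by
  rw [← aeval_eq_eval, ← aeval_eq_eval]
  rw [← AlgHom.comp_apply, comp_aeval]

theorem eval_conic (x : Fin 3 → ℂ) : eval x (X 0 ^ 2 + X 1 ^ 2) = x 0 ^ 2 + x 1 ^ 2 := by simp

theorem isHomogeneous_conic : (X 0 ^ 2 + X 1 ^ 2 : MvPolynomial (Fin 3) ℂ).IsHomogeneous 2 :=
  (isHomogeneous_X_pow _ _).add (isHomogeneous_X_pow _ _)

/-- A line with general coefficient vector contains a point at which the form `F` does not
vanish. -/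
theorem exists_ne_zero_on_general_line {F : MvPolynomial (Fin 3) ℂ} (hF : F ≠ 0) :
    ∃ R : MvPolynomial (Fin 3) ℂ, R ≠ 0 ∧ ∀ q, eval q R ≠ 0 → q 2 ≠ 0 ∧
      ∃ y : Fin 3 → ℂ, ∑ i, q i * y i = 0 ∧ eval y F ≠ 0 := by
  obtain ⟨x, hx⟩ := exists_eval_ne_zero (mul_ne_zero hF (X_ne_zero (0 : Fin 3)))
  rw [map_mul, eval_X] at hx
  have hx0 := right_ne_zero_of_mul hx
  -- The intersection of the line `q` with the line joining `(0 : 0 : 1)` to `x`. It equals `x` for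
  -- `q = (-x 2 / x 0, 0, 1)`.
  set y : Fin 3 → MvPolynomial (Fin 3) ℂ :=
    ![C (x 0) * X 2, C (x 1) * X 2, -(C (x 0) * X 0) - C (x 1) * X 1] with hy
  have hev : ∀ q, eval q (aeval y F) =
      eval ![x 0 * q 2, x 1 * q 2, -(x 0 * q 0) - x 1 * q 1] F := fun q => by
    rw [eval_aeval]
    congr 2
    ext i
    fin_cases i <;> simp [hy]
  refine ⟨X 2 * aeval y F, fun h => ?_, fun q hq => ?_⟩
  · have := congrArg (eval ![-(x 2 / x 0), 0, 1]) h
    rw [map_mul, hev, map_zero] at this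
    simp only [eval_X, Matrix.cons_val, one_mul, mul_one, mul_zero, sub_zero] at this
    apply left_ne_zero_of_mul hx
    rw [← this]
    congr 1
    congr 1
    ext i
    fin_cases i
    · rfl
    · rfl
    · simp
      field_simp
  · rw [map_mul, hev, eval_X] at hq
    refine ⟨left_ne_zero_of_mul hq, _, ?_, right_ne_zero_of_mul hq⟩
    simp [Fin.sum_univ_three]
    ring

section Parametrization

variable {c : ℕ} {G : MvPolynomial (Fin 3) ℂ} {p : Fin 3 → Polynomial ℂ}

/-- A nonzero form of degree less than `c` does not vanish on a rational curve of degree `c`. -/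
theorem IsParametrization.aeval_ne_zero (hp : IsParametrization c G p)
    {F : MvPolynomial (Fin 3) ℂ} {n : ℕ} (hF : F.IsHomogeneous n) (hn : n < c) (hF0 : F ≠ 0) :
    aeval p F ≠ 0 := by
  intro h
  obtain ⟨R, hR, hRq⟩ := exists_ne_zero_on_general_line hF0
  obtain ⟨b, hb, hinj⟩ := hp.generically_injective
  obtain ⟨q, hq, Z, hZ, hZq⟩ := exists_general_section p c hp.natDegree_le hp.coeff_ne_zero
    hp.eval_ne_zero hb hR
  obtain ⟨hq2, y, hy, hFy⟩ := hRq q hq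
  refine hFy (eval_eq_zero_of_line hF (fun h => hq2 (by rw [h]; rfl)) Z
    (fun z i => (p i).eval z) (fun z _ => hp.eval_ne_zero z) (fun z hz => (hZq z hz).2)
    (fun z _ => ?_) (fun z hz z' _ r hr => hinj z z' r (hZq z hz).1 hr) (by omega) hy)
  rw [← polynomial_eval_aeval, h, Polynomial.eval_zero]

/-- Otherwise the curve would lie in a line through `(0 : 0 : 1)`. Then `G` would vanish on that
whole line, contrary to its nonzero `w ^ c` coefficient. -/
theorem IsParametrization.isotropic_ne_zero (hp : IsParametrization c G p)
    (hG : G.IsHomogeneous c) (hw : eval ![0, 0, 1] G ≠ 0) (κ : ℂ) :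
    p 0 - Polynomial.C κ * p 1 ≠ 0 := by
  classical
  intro h
  obtain ⟨b, hb, hinj⟩ := hp.generically_injective
  obtain ⟨Z, hZ⟩ := Infinite.exists_superset_card_eq b.roots.toFinset
    (b.roots.toFinset.card + (c + 1)) (by omega)
  refine hw (eval_eq_zero_of_line hG (q := ![1, -κ, 0]) ?_ (Z \ b.roots.toFinset)
    (fun z i => (p i).eval z) (fun z _ => hp.eval_ne_zero z) (fun z _ => ?_) (fun z _ => ?_)
    (fun z hz z' _ r hr => hinj z z' r ?_ hr) ?_ ?_)
  · intro h
    have := congr_fun h 0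
    simp at this
  · have := congrArg (Polynomial.eval z) h
    simp only [Polynomial.eval_sub, Polynomial.eval_mul, Polynomial.eval_C,
      Polynomial.eval_zero] at this
    simp only [Fin.sum_univ_three, Matrix.cons_val]
    linear_combination this
  · rw [← polynomial_eval_aeval, hp.aeval_eq_zero, Polynomial.eval_zero]
  · simpa [hb] using (Finset.mem_sdiff.mp hz).2
  · rw [Finset.card_sdiff_of_subset hZ.1, hZ.2]
    omega
  · simp [Fin.sum_univ_three]

theorem aeval_conic_eq (p : Fin 3 → Polynomial ℂ) :
    aeval p (X 0 ^ 2 + X 1 ^ 2 : MvPolynomial (Fin 3) ℂ) =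
      (p 0 - Polynomial.C Complex.I * p 1) * (p 0 - Polynomial.C (-Complex.I) * p 1) := by
  have : Polynomial.C Complex.I * Polynomial.C Complex.I = -1 := by
    rw [← Polynomial.C_mul, Complex.I_mul_I, Polynomial.C_neg, Polynomial.C_1]
  simp only [map_add, map_pow, aeval_X, Polynomial.C_neg]
  linear_combination (p 1) ^ 2 * this

theorem IsParametrization.conic_ne_zero (hp : IsParametrization c G p)
    (hG : G.IsHomogeneous c) (hw : eval ![0, 0, 1] G ≠ 0) :
    aeval p (X 0 ^ 2 + X 1 ^ 2 : MvPolynomial (Fin 3) ℂ) ≠ 0 := by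
  rw [aeval_conic_eq]
  exact mul_ne_zero (hp.isotropic_ne_zero hG hw _) (hp.isotropic_ne_zero hG hw _)

/-- A form of degree `c` vanishing on the conic `u² + v² = 0` and on a rational curve of degree `c`
is zero. -/
theorem IsParametrization.eq_zero_of_conic (hp : IsParametrization c G p)
    (hG : G.IsHomogeneous c) (hw : eval ![0, 0, 1] G ≠ 0)
    {H : MvPolynomial (Fin 3) ℂ} (hH : H.IsHomogeneous c) (hpH : aeval p H = 0)
    (hiso : ∀ κ : ℂ, κ ^ 2 = -1 → ∀ v w, eval ![κ * v, v, w] H = 0) : H = 0 := by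
  classical
  by_contra hH0
  obtain ⟨R, hR, hRq⟩ := exists_ne_zero_on_general_line hH0
  obtain ⟨b, hb, hinj⟩ := hp.generically_injective
  obtain ⟨q, hq, Z, hZ, hZq⟩ := exists_general_section p c hp.natDegree_le hp.coeff_ne_zero
    hp.eval_ne_zero (mul_ne_zero hb (hp.conic_ne_zero hG hw)) hR
  obtain ⟨hq2, y, hy, hFy⟩ := hRq q hq
  set κ : Bool → ℂ := fun ε => bif ε then Complex.I else -Complex.I with hκ
  have hκ2 : ∀ ε, κ ε ^ 2 = -1 := by rintro (_ | _) <;> simp [hκ]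
  have hκinj : ∀ ε ε', κ ε = κ ε' → ε = ε' := by
    have h2 : (2 : ℂ) * Complex.I ≠ 0 := mul_ne_zero two_ne_zero Complex.I_ne_zero
    rintro (_ | _) (_ | _) h <;> simp only [hκ, cond_true, cond_false] at h ⊢
    · exact absurd (by linear_combination -h) h2
    · exact absurd (by linear_combination h) h2
  -- The `c` points of the curve on the line `q`, together with the two points of the conic on it.
  set x : ℂ ⊕ Bool → Fin 3 → ℂ := Sum.elim (fun z i => (p i).eval z)
    (fun ε => ![κ ε * q 2, q 2, -(κ ε * q 0 + q 1)]) with hx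
  have hoff : ∀ z ∈ Z, (p 0).eval z ^ 2 + (p 1).eval z ^ 2 ≠ 0 := fun z hz => by
    have := (hZq z hz).1
    rw [Polynomial.eval_mul, polynomial_eval_aeval, eval_conic] at this
    exact right_ne_zero_of_mul this
  have hon : ∀ ε, (κ ε * q 2) ^ 2 + q 2 ^ 2 = 0 := fun ε => by
    linear_combination q 2 ^ 2 * hκ2 ε
  refine hFy (eval_eq_zero_of_line hH (fun h => hq2 (by rw [h]; rfl))
    (Z.disjSum Finset.univ) x ?_ ?_ ?_ ?_ ?_ hy)
  · rintro (z | ε) _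
    · exact hp.eval_ne_zero z
    · exact fun h => hq2 (congr_fun h 1)
  · rintro (z | ε) hz
    · exact (hZq z (by simpa using hz)).2
    · simp only [hx, Sum.elim_inr, Fin.sum_univ_three, Matrix.cons_val]
      ring
  · rintro (z | ε) _
    · simp only [hx, Sum.elim_inl]
      rw [← polynomial_eval_aeval, hpH, Polynomial.eval_zero]
    · exact hiso _ (hκ2 ε) _ _
  · rintro (z | ε) hz (z' | ε') hz' r hr
    · rw [Finset.inl_mem_disjSum] at hz
      have := (hZq z hz).1
      rw [Polynomial.eval_mul] at this
      rw [hinj z z' r (left_ne_zero_of_mul this) hr]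
    · exfalso
      rw [Finset.inl_mem_disjSum] at hz
      have h0 : κ ε' * q 2 = r * (p 0).eval z := congr_fun hr 0
      have h1 : q 2 = r * (p 1).eval z := congr_fun hr 1
      have h2 : r ^ 2 * ((p 0).eval z ^ 2 + (p 1).eval z ^ 2) = 0 := by
        linear_combination hon ε' - (κ ε' * q 2 + r * (p 0).eval z) * h0 -
          (q 2 + r * (p 1).eval z) * h1
      have hr0 : r ≠ 0 := by
        rintro rfl
        rw [zero_mul] at h1
        exact hq2 h1
      exact mul_ne_zero (pow_ne_zero 2 hr0) (hoff z hz) h2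
    · exfalso
      rw [Finset.inl_mem_disjSum] at hz'
      have h0 : (p 0).eval z' = r * (κ ε * q 2) := congr_fun hr 0
      have h1 : (p 1).eval z' = r * q 2 := congr_fun hr 1
      apply hoff z' hz'
      rw [h0, h1]
      linear_combination r ^ 2 * hon ε
    · have h0 : κ ε' * q 2 = r * (κ ε * q 2) := congr_fun hr 0
      have h1 : q 2 = r * q 2 := congr_fun hr 1
      have : κ ε' = κ ε := by
        apply mul_right_cancel₀ hq2
        linear_combination h0 - κ ε * h1
      rw [hκinj _ _ this]
  · rw [Finset.card_disjSum, hZ]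
    simp

end Parametrization

/-- Every base of the plane of binary parameters gives an affine parametrization. -/
theorem isParametrization_of_basis {c : ℕ} {G : MvPolynomial (Fin 3) ℂ}
    {φ : Fin 3 → MvPolynomial (Fin 2) ℂ} (hhom : ∀ i, (φ i).IsHomogeneous c)
    (hne : ∀ t : Fin 2 → ℂ, t ≠ 0 → ∃ i, eval t (φ i) ≠ 0)
    (hG : ∀ t : Fin 2 → ℂ, eval (fun i => eval t (φ i)) G = 0)
    {R : MvPolynomial (Fin 2) ℂ} (hR : R ≠ 0)
    (hinj : ∀ s t : Fin 2 → ℂ, s ≠ 0 → t ≠ 0 → eval s R ≠ 0 →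
        (∃ r : ℂ, (fun i => eval t (φ i)) = r • (fun i => eval s (φ i))) → ∃ r : ℂ, t = r • s)
    {e e' : Fin 2 → ℂ} (hdet : e 0 * e' 1 - e 1 * e' 0 ≠ 0) :
    ∃ p : Fin 3 → Polynomial ℂ, IsParametrization c G p ∧
      (∀ i, (p i).coeff c = eval e (φ i)) ∧ ∀ t i, (p i).eval t = eval (t • e + e') (φ i) := by
  set L : Fin 2 → Polynomial ℂ := fun j => Polynomial.C (e j) * Polynomial.X + Polynomial.C (e' j)
    with hL
  have hLdeg : ∀ j, (L j).natDegree ≤ 1 := fun j => Polynomial.natDegree_linear_le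
  have hev : ∀ (F : MvPolynomial (Fin 2) ℂ) t, (aeval L F).eval t = eval (t • e + e') F :=
    fun F t => by
      rw [polynomial_eval_aeval]
      congr 1
      congr 1
      ext i
      simp [hL]
      ring
  have hpt : ∀ t : ℂ, t • e + e' ≠ 0 := fun t h => by
    have h0 := congr_fun h 0
    have h1 := congr_fun h 1
    simp at h0 h1
    exact hdet (by linear_combination e 0 * h1 - e 1 * h0)
  have hcoeff : ∀ i, (aeval L (φ i)).coeff c = eval e (φ i) := fun i => by
    have := (aeval_natDegree_coeff (hhom i) L 1 hLdeg).2
    rw [mul_one] at this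
    rw [this]
    congr 1
    congr 1
    ext j
    simp [hL]
  refine ⟨fun i => aeval L (φ i), ⟨fun i => ?_, ?_, fun t h => ?_, ?_, ?_⟩, hcoeff,
    fun t i => hev _ t⟩
  · simpa using (aeval_natDegree_coeff (hhom i) L 1 hLdeg).1
  · intro h
    obtain ⟨i, hi⟩ := hne e (by rintro rfl; simp at hdet)
    exact hi (by rw [← hcoeff]; exact congr_fun h i)
  · obtain ⟨i, hi⟩ := hne _ (hpt t)
    exact hi (by rw [← hev]; exact congr_fun h i)
  · apply Polynomial.funext
    intro t
    rw [polynomial_eval_aeval, Polynomial.eval_zero]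
    simp only [hev]
    exact hG _
  · have hlin : (C (e 0) * X 1 - C (e 1) * X 0 : MvPolynomial (Fin 2) ℂ) ≠ 0 := fun h => by
      have := congrArg (eval e') h
      simp at this
      exact hdet this
    obtain ⟨q, hq⟩ := exists_eval_ne_zero (mul_ne_zero hR hlin)
    simp only [map_mul, map_sub, eval_C, eval_X] at hq
    have hqR := left_ne_zero_of_mul hq
    have hql := right_ne_zero_of_mul hq
    -- `R` need not be homogeneous, so it could vanish on the affine line `t • e + e'`. The rescaled
    -- line passes through `q`, where `R` is nonzero.
    set μ : ℂ := (e 0 * q 1 - e 1 * q 0) / (e 0 * e' 1 - e 1 * e' 0) with hμ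
    have hμ0 : μ ≠ 0 := div_ne_zero hql hdet
    set L' : Fin 2 → Polynomial ℂ := fun j => Polynomial.C μ * L j with hL'
    have hev' : ∀ t, (aeval L' R).eval t = eval (μ • (t • e + e')) R := fun t => by
      rw [polynomial_eval_aeval]
      congr 1
      congr 1
      ext i
      simp only [hL', hL, Polynomial.eval_mul, Polynomial.eval_add, Polynomial.eval_C,
        Polynomial.eval_X, Pi.smul_apply, Pi.add_apply, smul_eq_mul]
      ring
    refine ⟨aeval L' R, fun h => hqR ?_, fun s t r hs hst => ?_⟩
    · have hq' : q = μ • ((((q 0 * e' 1 - q 1 * e' 0) / (e 0 * e' 1 - e 1 * e' 0)) / μ) • e + e') := by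
        rw [smul_add, smul_smul, mul_div_cancel₀ _ hμ0]
        ext j
        simp only [hμ, Pi.add_apply, Pi.smul_apply, smul_eq_mul]
        rw [div_mul_eq_mul_div, div_mul_eq_mul_div, ← add_div, eq_div_iff hdet]
        fin_cases j <;> simp <;> ring
      rw [hq', ← hev', h, Polynomial.eval_zero]
    · rw [hev'] at hs
      simp only [hev] at hst
      obtain ⟨ρ, hρ⟩ := hinj (μ • (s • e + e')) (t • e + e')
        (smul_ne_zero hμ0 (hpt s)) (hpt t) hs ⟨r / μ ^ c, by
          rw [hst]
          ext i
          simp only [Pi.smul_apply, smul_eq_mul, eval_smul_of_isHomogeneous (hhom i) μ]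
          field_simp⟩
      have h0 := congr_fun hρ 0
      have h1 := congr_fun hρ 1
      simp only [Pi.add_apply, Pi.smul_apply, smul_eq_mul] at h0 h1
      have k1 : (1 - ρ * μ) * (e 0 * e' 1 - e 1 * e' 0) = 0 := by
        linear_combination e 0 * h1 - e 1 * h0
      have k2 : (t - ρ * μ * s) * (e 0 * e' 1 - e 1 * e' 0) = 0 := by
        linear_combination e' 1 * h0 - e' 0 * h1
      have k1' := (mul_eq_zero.mp k1).resolve_right hdet
      have k2' := (mul_eq_zero.mp k2).resolve_right hdet
      linear_combination k2' - s * k1'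

/-- A rational curve has a parametrization whose point at infinity is a nonsingular point outside
the conic `u² + v² = 0`. -/
theorem exists_parametrization {c : ℕ} {G : MvPolynomial (Fin 3) ℂ} (hG : G.IsHomogeneous c)
    (hc : 0 < c) (hw : eval ![0, 0, 1] G ≠ 0) (hrat : IsRational c G) :
    ∃ p, IsParametrization c G p ∧ grad G (fun i => (p i).coeff c) ≠ 0 ∧
      (p 0).coeff c ^ 2 + (p 1).coeff c ^ 2 ≠ 0 := by
  obtain ⟨φ, hhom, hne, hGφ, R, hR, hinj⟩ := hrat
  -- This auxiliary chart only serves to show that the required pullbacks to binary forms are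
  -- nonzero. The final chart puts a general `e` at infinity.
  obtain ⟨p, hp, -, hpe⟩ := isParametrization_of_basis hhom hne hGφ hR hinj
    (e := ![1, 0]) (e' := ![0, 1]) (by simp)
  have hpull : ∀ F, aeval p F ≠ 0 → aeval φ F ≠ 0 := fun F hF h => by
    apply hF
    apply Polynomial.funext
    intro t
    rw [polynomial_eval_aeval, Polynomial.eval_zero]
    simp only [hpe]
    rw [← eval_aeval, h, map_zero]
  obtain ⟨i, hi⟩ : ∃ i, pderiv i G ≠ 0 := by
    by_contra! h
    have := euler_eval hG ![0, 0, 1]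
    simp only [grad, h, map_zero, zero_mul, Finset.sum_const_zero] at this
    exact mul_ne_zero (Nat.cast_ne_zero.mpr hc.ne') hw this.symm
  obtain ⟨e, he⟩ := exists_eval_ne_zero
    (mul_ne_zero (hpull _ (hp.aeval_ne_zero (hG.pderiv (i := i)) (by omega) hi))
      (hpull _ (hp.conic_ne_zero hG hw)))
  rw [map_mul, eval_aeval, eval_aeval, eval_conic] at he
  have he0 : e ≠ 0 := by
    rintro rfl
    apply right_ne_zero_of_mul he
    have : ∀ i, eval 0 (φ i) = 0 := fun i => by
      have := eval_smul_of_isHomogeneous (hhom i) 0 0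
      rwa [zero_smul, zero_pow hc.ne', zero_mul] at this
    rw [this, this, zero_pow two_ne_zero, add_zero]
  obtain ⟨e', he'⟩ : ∃ e' : Fin 2 → ℂ, e 0 * e' 1 - e 1 * e' 0 ≠ 0 := by
    by_contra! h
    apply he0
    ext j
    fin_cases j
    · simpa using h ![0, 1]
    · simpa using h ![1, 0]
  obtain ⟨p, hp, hpc, -⟩ := isParametrization_of_basis hhom hne hGφ hR hinj he'
  refine ⟨p, hp, fun h => left_ne_zero_of_mul he ?_, ?_⟩
  · simp only [hpc] at h
    exact congr_fun h i
  · rw [hpc, hpc]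
    exact right_ne_zero_of_mul he

/-! ### The class of a rational curve and the equiclassical ideal along it -/

/-- The common factor of a nonzero triple of polynomials. -/
theorem exists_common_factor {g : Fin 3 → Polynomial ℂ} (hg : g ≠ 0) :
    ∃ (A : Polynomial ℂ) (ψ : Fin 3 → Polynomial ℂ), A ≠ 0 ∧ (∀ i, g i = A * ψ i) ∧
      ∀ t, (fun i => (ψ i).eval t) ≠ 0 := by
  obtain ⟨A, hA⟩ := (IsPrincipalIdealRing.principal (Ideal.span (Set.range g))).principal
  have hdvd : ∀ i, A ∣ g i := fun i => by
    rw [← Ideal.mem_span_singleton]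
    change g i ∈ Submodule.span _ {A}
    rw [← hA]
    exact Ideal.subset_span ⟨i, rfl⟩
  choose ψ hψ using hdvd
  have hA0 : A ≠ 0 := by
    rintro rfl
    apply hg
    ext1 i
    rw [hψ i, zero_mul, Pi.zero_apply]
  refine ⟨A, ψ, hA0, hψ, fun t ht => ?_⟩
  have hmem : A ∈ Ideal.span (Set.range g) := by
    rw [hA]
    exact Submodule.mem_span_singleton_self A
  obtain ⟨a, ha⟩ := (Submodule.mem_span_range_iff_exists_fun (Polynomial ℂ)).mp hmem
  have h1 : ∑ i, a i * ψ i = 1 := by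
    apply mul_left_cancel₀ hA0
    rw [mul_one, Finset.mul_sum]
    conv_rhs => rw [← ha]
    refine Finset.sum_congr rfl fun i _ => ?_
    rw [smul_eq_mul, hψ i]
    ring
  have := congrArg (Polynomial.eval t) h1
  have ht' : ∀ i, (ψ i).eval t = 0 := fun i => congr_fun ht i
  simp [Polynomial.eval_finsetSum, ht'] at this

/-- The class of a rational curve is at least the degree of the dual parametrization. -/
theorem degree_dual_le_class {c D d : ℕ} {G : MvPolynomial (Fin 3) ℂ} {p : Fin 3 → Polynomial ℂ}
    (hp : IsParametrization c G p) (hG : G.IsHomogeneous c) (hd : HasClass G d)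
    {A : Polynomial ℂ} {ψ : Fin 3 → Polynomial ℂ} (hA : A ≠ 0)
    (hAψ : ∀ i, aeval p (pderiv i G) = A * ψ i) (hψ : ∀ t, (fun i => (ψ i).eval t) ≠ 0)
    (hdeg : ∀ i, (ψ i).natDegree ≤ D) (hD : (fun i => (ψ i).coeff D) ≠ 0) : D ≤ d := by
  classical
  obtain ⟨R, hR, hRd⟩ := hd
  obtain ⟨b, hb, hinj⟩ := hp.generically_injective
  obtain ⟨q, hq, Z, hZ, hZq⟩ := exists_general_section ψ D hdeg hD hψ (mul_ne_zero hb hA) hR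
  set f : ℂ → Projectivization ℂ (Fin 3 → ℂ) := fun z =>
    Projectivization.mk ℂ (fun i => (p i).eval z) (hp.eval_ne_zero z) with hf
  have hgrad : ∀ z i, eval (fun i => (p i).eval z) (pderiv i G) = A.eval z * (ψ i).eval z :=
    fun z i => by rw [← polynomial_eval_aeval, hAψ, Polynomial.eval_mul]
  -- Away from the zeros of `A` the gradient is a nonzero multiple of `ψ`, so the zeros of the
  -- section `∑ i, q i * ψ i` are contacts of tangents through `q`.
  have hmem : ∀ z ∈ Z, f z ∈ contactPoints G q := fun z hz => by
    obtain ⟨a, ha⟩ := Projectivization.exists_smul_eq_mk_rep ℂ (fun i => (p i).eval z)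
      (hp.eval_ne_zero z)
    have hb := (hZq z hz).1
    rw [Polynomial.eval_mul] at hb
    change eval (Projectivization.mk ℂ (fun i => (p i).eval z) (hp.eval_ne_zero z)).rep G = 0 ∧
      grad G (Projectivization.mk ℂ (fun i => (p i).eval z) (hp.eval_ne_zero z)).rep ≠ 0 ∧
      ∑ i, grad G (Projectivization.mk ℂ (fun i => (p i).eval z) (hp.eval_ne_zero z)).rep i * q i = 0
    rw [← ha, Units.smul_def]
    have hg : ∀ i, grad G ((a : ℂ) • fun i => (p i).eval z) i =
        ((a : ℂ) ^ (c - 1) * A.eval z) * (ψ i).eval z := fun i => by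
      rw [grad, eval_smul_of_isHomogeneous hG.pderiv, hgrad, mul_assoc]
    refine ⟨?_, fun h => hψ z ?_, ?_⟩
    · rw [eval_smul_of_isHomogeneous hG, ← polynomial_eval_aeval, hp.aeval_eq_zero,
        Polynomial.eval_zero, mul_zero]
    · ext i
      have := congr_fun h i
      rw [hg] at this
      exact (mul_eq_zero.mp this).resolve_left
        (mul_ne_zero (pow_ne_zero _ a.ne_zero) (right_ne_zero_of_mul hb))
    · simp only [hg]
      have := (hZq z hz).2
      calc ∑ i, (a : ℂ) ^ (c - 1) * A.eval z * (ψ i).eval z * q i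
          = ((a : ℂ) ^ (c - 1) * A.eval z) * ∑ i, q i * (ψ i).eval z := by
            rw [Finset.mul_sum]
            exact Finset.sum_congr rfl fun i _ => by ring
        _ = 0 := by rw [this, mul_zero]
  have hfinj : Set.InjOn f Z := fun z hz z' hz' h => by
    rw [hf] at h
    obtain ⟨r, hr⟩ := (Projectivization.mk_eq_mk_iff' ℂ _ _ (hp.eval_ne_zero z)
      (hp.eval_ne_zero z')).mp h
    have hb := (hZq z' hz').1
    rw [Polynomial.eval_mul] at hb
    exact hinj z' z r (left_ne_zero_of_mul hb) hr.symm
  have hle := Set.encard_le_encard (s := f '' Z) (t := contactPoints G q) (by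
    rintro _ ⟨z, hz, rfl⟩
    exact hmem z hz)
  rw [hfinj.encard_image, hRd q hq, Set.encard_coe_eq_coe_finsetCard, hZ] at hle
  exact_mod_cast hle

/-! ### Forms and their coefficient vectors -/

theorem isHomogeneous_form {K : Type*} [CommRing K] {c : ℕ} (a : Mono c → K) :
    (form a).IsHomogeneous c := by
  refine IsHomogeneous.sum _ _ _ fun m _ => isHomogeneous_monomial _ ?_
  rw [Finsupp.degree_eq_sum]
  exact (Finset.mem_finsuppAntidiag.mp m.2).1

theorem form_add {K : Type*} [CommRing K] {c : ℕ} (a b : Mono c → K) :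
    form (a + b) = form a + form b := by
  simp [form, Finset.sum_add_distrib]

theorem form_smul {K : Type*} [CommRing K] {c : ℕ} (r : K) (a : Mono c → K) :
    form (r • a) = r • form a := by
  simp [form, Finset.smul_sum, smul_monomial]

theorem coeff_form {K : Type*} [CommRing K] {c : ℕ} (a : Mono c → K) (m : Mono c) :
    coeff m.1 (form a) = a m := by
  classical
  rw [form, coeff_sum, Finset.sum_eq_single m]
  · simp
  · intro m' _ h
    rw [coeff_monomial, if_neg fun h' => h (Subtype.ext h')]
  · simp

theorem eval_form_wTop {K : Type*} [CommRing K] {c : ℕ} (a : Mono c → K) :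
    eval ![0, 0, 1] (form a) = a (wTop c) := by
  classical
  rw [form, map_sum, Finset.sum_eq_single (wTop c)]
  · simp [wTop, eval_monomial]
  · intro m _ h
    rw [eval_monomial, Finsupp.prod_fintype _ _ (by simp), Fin.prod_univ_three]
    by_cases h0 : m.1 0 = 0
    · by_cases h1 : m.1 1 = 0
      · exfalso
        apply h
        apply Subtype.ext
        have := (Finset.mem_finsuppAntidiag.mp m.2).1
        rw [Fin.sum_univ_three, h0, h1] at this
        ext i
        fin_cases i
        · simpa [wTop] using h0
        · simpa [wTop] using h1
        · simpa [wTop] using this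
      · simp [h1]
    · simp [h0]
  · simp

/-- The pull-back of forms to a parametrized curve. -/
def pullback (c : ℕ) (p : Fin 3 → Polynomial ℂ) : (Mono c → ℂ) →ₗ[ℂ] Polynomial ℂ where
  toFun h := aeval p (form h)
  map_add' a b := by rw [form_add, map_add]
  map_smul' r a := by rw [form_smul, map_smul, RingHom.id_apply]

/-! ### Divisibility by the conic and dimension counts -/

theorem aeval_sub_aeval_dvd (p p' : Fin 3 → Polynomial ℂ) (f : Polynomial ℂ)
    (h : ∀ i, f ∣ p i - p' i) (H : MvPolynomial (Fin 3) ℂ) : f ∣ aeval p H - aeval p' H := by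
  rw [← Ideal.mem_span_singleton, ← Ideal.Quotient.mk_eq_mk_iff_sub_mem]
  have e : ∀ p : Fin 3 → Polynomial ℂ, Ideal.Quotient.mk (Ideal.span {f}) (aeval p H) =
      aeval (fun i => Ideal.Quotient.mkₐ ℂ (Ideal.span {f}) (p i)) H := fun p => by
    change (Ideal.Quotient.mkₐ ℂ (Ideal.span {f})) (aeval p H) = _
    rw [← AlgHom.comp_apply, comp_aeval]
  rw [e, e]
  congr 2
  ext1 i
  exact (Ideal.Quotient.mk_eq_mk_iff_sub_mem _ _).mpr (Ideal.mem_span_singleton.mpr (h i))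

/-- Modulo `p 0 - κ p 1` the arc lies on the line `u = κ v`, on which `H` vanishes. -/
theorem isotropic_dvd {H : MvPolynomial (Fin 3) ℂ} {κ : ℂ} (p : Fin 3 → Polynomial ℂ)
    (hiso : ∀ v w, eval ![κ * v, v, w] H = 0) : p 0 - Polynomial.C κ * p 1 ∣ aeval p H := by
  have h := aeval_sub_aeval_dvd p ![Polynomial.C κ * p 1, p 1, p 2] (p 0 - Polynomial.C κ * p 1)
    (fun i => by fin_cases i <;> simp) H
  have h0 : aeval ![Polynomial.C κ * p 1, p 1, p 2] H = 0 := by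
    apply Polynomial.funext
    intro t
    rw [polynomial_eval_aeval, Polynomial.eval_zero, ← hiso ((p 1).eval t) ((p 2).eval t)]
    congr 2
    ext i
    fin_cases i <;> simp
  rwa [h0, sub_zero] at h

theorem isCoprime_of_no_common_root {f g : Polynomial ℂ} (hf : f ≠ 0)
    (h : ∀ t, f.eval t = 0 → g.eval t ≠ 0) : IsCoprime f g :=
  isCoprime_of_irreducible_dvd (fun h' => hf h'.1) fun z hz h₀ h₁ => by
    obtain ⟨s, hs⟩ := IsAlgClosed.exists_root z (Polynomial.degree_pos_of_irreducible hz).ne'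
    exact h s (hs.dvd h₀) (hs.dvd h₁)

/-- The two linear factors are coprime: a common zero would put `(0 : 0 : 1)` on the curve. -/
theorem IsParametrization.conic_dvd {c : ℕ} {G H : MvPolynomial (Fin 3) ℂ}
    {p : Fin 3 → Polynomial ℂ} (hp : IsParametrization c G p) (hG : G.IsHomogeneous c)
    (hw : eval ![0, 0, 1] G ≠ 0)
    (hiso : ∀ κ : ℂ, κ ^ 2 = -1 → ∀ v w, eval ![κ * v, v, w] H = 0) :
    aeval p (X 0 ^ 2 + X 1 ^ 2 : MvPolynomial (Fin 3) ℂ) ∣ aeval p H := by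
  rw [aeval_conic_eq]
  refine IsCoprime.mul_dvd ?_ (isotropic_dvd p (hiso _ (by simp)))
    (isotropic_dvd p (hiso _ (by simp)))
  refine isCoprime_of_no_common_root (hp.isotropic_ne_zero hG hw _) fun t h1 h2 => ?_
  simp only [Polynomial.eval_sub, Polynomial.eval_mul, Polynomial.eval_C] at h1 h2
  have k1 : (p 1).eval t = 0 := by
    have : (2 * Complex.I) * (p 1).eval t = 0 := by linear_combination h2 - h1
    exact (mul_eq_zero.mp this).resolve_left (mul_ne_zero two_ne_zero Complex.I_ne_zero)
  have k0 : (p 0).eval t = 0 := by linear_combination h1 + Complex.I * k1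
  have e : (fun i => (p i).eval t) = (p 2).eval t • ![0, 0, 1] := by
    ext i
    fin_cases i <;> simp [k0, k1]
  have k2 : eval (fun i => (p i).eval t) G = 0 := by
    rw [← polynomial_eval_aeval, hp.aeval_eq_zero, Polynomial.eval_zero]
  rw [e, eval_smul_of_isHomogeneous hG] at k2
  have k3 := eq_zero_of_pow_eq_zero ((mul_eq_zero.mp k2).resolve_right hw)
  exact hp.eval_ne_zero t (by rw [e, k3, zero_smul])

theorem finrank_le_of_dvd (V : Submodule ℂ (Polynomial ℂ)) {B : Polynomial ℂ} (hB : B ≠ 0) (N : ℕ)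
    (h : ∀ f ∈ V, B ∣ f ∧ f.natDegree ≤ N) : Module.finrank ℂ V ≤ N + 1 - B.natDegree := by
  set k := N + 1 - B.natDegree with hk
  have hle : V ≤ (Polynomial.degreeLT ℂ k).map (LinearMap.mulLeft ℂ B) := fun f hf => by
    obtain ⟨⟨Q, rfl⟩, hdeg⟩ := h f hf
    refine ⟨Q, ?_, rfl⟩
    rcases eq_or_ne Q 0 with rfl | hQ
    · exact Submodule.zero_mem _
    · rw [Polynomial.natDegree_mul hB hQ] at hdeg
      rw [SetLike.mem_coe, Polynomial.mem_degreeLT, Polynomial.degree_eq_natDegree hQ]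
      exact_mod_cast (by omega : Q.natDegree < k)
  have e := (Polynomial.degreeLTEquiv ℂ k).finrank_eq
  rw [Module.finrank_fin_fun] at e
  have : FiniteDimensional ℂ (Polynomial.degreeLT ℂ k) :=
    Module.Finite.equiv (Polynomial.degreeLTEquiv ℂ k).symm
  exact ((Submodule.finrank_mono hle).trans (Submodule.finrank_map_le _ _)).trans e.le

/-- The common factor of the gradient along a rational curve has degree at least `c (c - 1) - d`. -/
theorem exists_gradient_factor {c d : ℕ} {G : MvPolynomial (Fin 3) ℂ} {p : Fin 3 → Polynomial ℂ}
    (hp : IsParametrization c G p) (hG : G.IsHomogeneous c) (hclass : HasClass G d)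
    (hgrad : grad G (fun i => (p i).coeff c) ≠ 0) :
    ∃ (A : Polynomial ℂ) (ψ : Fin 3 → Polynomial ℂ), A ≠ 0 ∧
      (∀ i, aeval p (pderiv i G) = A * ψ i) ∧ (c - 1) * c ≤ A.natDegree + d := by
  have hgdeg := fun i => aeval_natDegree_coeff (hG.pderiv (i := i)) p c hp.natDegree_le
  obtain ⟨i₀, hi₀⟩ := Function.ne_iff.mp hgrad
  -- As the gradient is nonzero at infinity, this partial derivative attains the full degree `(c -
  -- 1) * c`, and no zero of the gradient escapes the affine count.
  have hg₀ : (aeval p (pderiv i₀ G)).coeff ((c - 1) * c) ≠ 0 := by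
    rw [(hgdeg i₀).2]; exact hi₀
  obtain ⟨A, ψ, hA, hAψ, hψ⟩ := exists_common_factor (g := fun i => aeval p (pderiv i G))
    (fun h => hg₀ (by rw [show aeval p (pderiv i₀ G) = 0 from congr_fun h i₀,
      Polynomial.coeff_zero]))
  have hAle : A.natDegree ≤ (c - 1) * c := by
    refine (Polynomial.natDegree_le_of_dvd ⟨_, hAψ i₀⟩ fun h => ?_).trans (hgdeg i₀).1
    rw [h, Polynomial.coeff_zero] at hg₀
    exact hg₀ rfl
  obtain ⟨D, hD⟩ := Nat.exists_eq_add_of_le hAle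
  have hψdeg : ∀ i, (ψ i).natDegree ≤ D := fun i => by
    rcases eq_or_ne (ψ i) 0 with h | h
    · simp [h]
    · have := (hgdeg i).1
      rw [hAψ, Polynomial.natDegree_mul hA h] at this
      omega
  have hψD : (fun i => (ψ i).coeff D) ≠ 0 := fun h => hg₀ (by
    rw [hAψ, hD, Polynomial.coeff_mul_add_eq_of_natDegree_le le_rfl (hψdeg i₀),
      show (ψ i₀).coeff D = 0 from congr_fun h i₀, mul_zero])
  refine ⟨A, ψ, hA, hAψ, ?_⟩
  rw [hD]
  exact Nat.add_le_add_left (degree_dual_le_class hp hG hclass hA hAψ hψ hψdeg hψD) _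

/-- The equiclassical sections of degree `c` that vanish on the conic `u² + v² = 0` form a space of
dimension at most `d - c + 1`. -/
theorem finrank_equiclassical_le {c d : ℕ} (a : Mono c → ℂ) (ha : a ∈ family c d) (hc : 0 < c)
    (hnc : IsNodalCuspidal (form a)) (hsing : SingDisjointFromIsotropic (form a))
    (V : Submodule ℂ (Mono c → ℂ)) (hI : ∀ h ∈ V, InEquiclassicalIdeal (form a) (form h))
    (hiso : ∀ h ∈ V, ∀ κ : ℂ, κ ^ 2 = -1 → ∀ v w, eval ![κ * v, v, w] (form h) = 0) :
    Module.finrank ℂ V ≤ d + 1 - c := by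
  obtain ⟨hw, -, hrat, hclass⟩ := ha
  have hG := isHomogeneous_form a
  have hw' : eval ![0, 0, 1] (form a) ≠ 0 := by rw [eval_form_wTop, hw]; exact one_ne_zero
  obtain ⟨p, hp, hgrad, hconic⟩ := exists_parametrization hG hc hw' hrat
  obtain ⟨A, ψ, hA, hAψ, hAd⟩ := exists_gradient_factor hp hG hclass hgrad
  set Q := aeval p (X 0 ^ 2 + X 1 ^ 2 : MvPolynomial (Fin 3) ℂ) with hQ
  have hQ0 : Q ≠ 0 := hp.conic_ne_zero hG hw'
  have hpG : ∀ t, eval (fun i => (p i).eval t) (form a) = 0 := fun t => by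
    rw [← polynomial_eval_aeval, hp.aeval_eq_zero, Polynomial.eval_zero]
  have hQdeg : Q.natDegree = 2 * c := by
    obtain ⟨h1, h2⟩ := aeval_natDegree_coeff isHomogeneous_conic p c hp.natDegree_le
    refine le_antisymm h1 (Polynomial.le_natDegree_of_ne_zero ?_)
    rw [hQ, h2, eval_conic]
    exact hconic
  have hAQ : IsCoprime A Q := isCoprime_of_no_common_root hA fun t ht => by
    rw [hQ, polynomial_eval_aeval, eval_conic]
    refine hsing _ ⟨hp.eval_ne_zero t, hpG t, ?_⟩
    ext i
    rw [grad, ← polynomial_eval_aeval, hAψ, Polynomial.eval_mul, ht, zero_mul, Pi.zero_apply]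
  have hAdvd : ∀ h ∈ V, A ∣ aeval p (form h) := fun h hh =>
    dvd_of_forall_pow_dvd hA fun t N hN =>
      equiclassical_arc_dvd hG (isHomogeneous_form h) hnc (hI h hh) (hp.eval_ne_zero t) (hpG t)
        fun i => by
          rw [hAψ]
          exact hN.mul_right _
  have hQdvd : ∀ h ∈ V, Q ∣ aeval p (form h) := fun h hh =>
    hp.conic_dvd hG hw' (hiso h hh)
  have hinj : Function.Injective ((pullback c p).domRestrict V) := by
    rw [← LinearMap.ker_eq_bot, LinearMap.ker_eq_bot']
    rintro ⟨h, hh⟩ hh0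
    have h0 := hp.eq_zero_of_conic hG hw' (isHomogeneous_form h) hh0 (hiso h hh)
    apply Subtype.ext
    ext m
    change h m = 0
    rw [← coeff_form h m, h0, coeff_zero]
  have hrange : ∀ f ∈ LinearMap.range ((pullback c p).domRestrict V),
      A * Q ∣ f ∧ f.natDegree ≤ c * c := by
    rintro _ ⟨h, rfl⟩
    change A * Q ∣ aeval p (form h.1) ∧ (aeval p (form h.1)).natDegree ≤ c * c
    exact ⟨hAQ.mul_dvd (hAdvd h.1 h.2) (hQdvd h.1 h.2),
      (aeval_natDegree_coeff (isHomogeneous_form h.1) p c hp.natDegree_le).1⟩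
  have hfin := finrank_le_of_dvd _ (mul_ne_zero hA hQ0) (c * c) hrange
  rw [LinearMap.finrank_range_of_inj hinj, Polynomial.natDegree_mul hA hQ0, hQdeg] at hfin
  -- With `deg A ≥ (c - 1) * c - d` the bound `c * c + 1 - (deg A + 2 * c)` becomes `d + 1 - c`.
  -- Truncated subtraction gives zero when `c > d + 1`.
  have hcc : c * c = (c - 1) * c + c := by
    rw [Nat.sub_one_mul, Nat.sub_add_cancel (Nat.le_mul_self c)]
  omega

/-! ### The focal map -/

theorem complexify_add {c : ℕ} (a b : Mono c → ℝ) :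
    complexify (a + b) = complexify a + complexify b := by
  ext m; simp [complexify]

theorem complexify_smul {c : ℕ} (r : ℝ) (a : Mono c → ℝ) :
    complexify (r • a) = (r : ℂ) • complexify a := by
  ext m; simp [complexify]

/-- The focal map as a linear map. -/
def focalLinear (c : ℕ) : (Mono c → ℝ) →ₗ[ℝ] (Fin c → ℂ) where
  toFun a k := (focalPoly a).coeff k
  map_add' a b := by
    ext k
    simp [focalPoly, complexify_add, form_add]
  map_smul' r a := by
    ext k
    change (focalPoly (r • a)).coeff k = r • (focalPoly a).coeff k
    rw [focalPoly, focalPoly, complexify_smul, form_smul, map_smul, Polynomial.coeff_smul,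
      smul_eq_mul, Complex.real_smul]

/-- Subtracting `X ^ c` does not affect coefficients below degree `c`, so the focal map is linear on
all coefficient vectors. -/
theorem focalMap_eq (c : ℕ) (a : Mono c → ℝ) : focalMap c a = focalLinear c a := by
  ext k
  rw [focalMap, Polynomial.coeff_sub, Polynomial.coeff_X_pow, if_neg k.2.ne, sub_zero]
  rfl

theorem focalDifferential_eq {c : ℕ} (W : Set (Mono c → ℝ)) (a : Mono c → ℝ) :
    focalDifferential W a = (focalLinear c).domRestrict (tangent W a) := by
  have h : focalMap c = ⇑(LinearMap.toContinuousLinearMap (focalLinear c)) :=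
    funext fun b => focalMap_eq c b
  rw [focalDifferential, h, ContinuousLinearMap.fderiv]
  rfl

theorem focalPoly_natDegree_coeff {c : ℕ} (a : Mono c → ℝ) :
    (focalPoly a).natDegree ≤ c ∧ (focalPoly a).coeff c = a (wTop c) := by
  have h := aeval_natDegree_coeff (isHomogeneous_form (complexify a))
    ![(-1 : Polynomial ℂ), -Polynomial.C Complex.I, Polynomial.X] 1 (fun i => by
      fin_cases i <;> simp)
  rw [mul_one] at h
  refine ⟨h.1, h.2.trans ?_⟩
  rw [show (a (wTop c) : ℂ) = complexify a (wTop c) from rfl,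
    ← eval_form_wTop (complexify a)]
  congr 2
  ext i
  fin_cases i <;> simp [Polynomial.coeff_one]

theorem focalPoly_eq_zero {c : ℕ} {a : Mono c → ℝ} (h : focalLinear c a = 0)
    (hw : a (wTop c) = 0) : focalPoly a = 0 := by
  ext k
  rw [Polynomial.coeff_zero]
  obtain ⟨h1, h2⟩ := focalPoly_natDegree_coeff a
  rcases lt_trichotomy k c with hk | rfl | hk
  · exact congr_fun h ⟨k, hk⟩
  · rw [h2, hw, Complex.ofReal_zero]
  · exact Polynomial.coeff_eq_zero_of_natDegree_lt (h1.trans_lt hk)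

theorem form_complexify {c : ℕ} (a : Mono c → ℝ) :
    form (complexify a) = map Complex.ofRealHom (form a) := by
  simp [form, complexify, map_monomial]

theorem conj_eval_map (F : MvPolynomial (Fin 3) ℝ) (x : Fin 3 → ℂ) :
    starRingEnd ℂ (eval x (map Complex.ofRealHom F)) =
      eval (fun i => starRingEnd ℂ (x i)) (map Complex.ofRealHom F) := by
  rw [eval_map, eval_map, eval₂_eq', eval₂_eq', map_sum]
  refine Finset.sum_congr rfl fun m _ => ?_
  simp [map_prod]

/-- A real form in the kernel of the focal map vanishes on the conic `u² + v² = 0`. -/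
theorem eval_isotropic_eq_zero {c : ℕ} {h : Mono c → ℝ} (hL : focalLinear c h = 0)
    (hw : h (wTop c) = 0) (κ : ℂ) (hκ : κ ^ 2 = -1) (v w : ℂ) :
    eval ![κ * v, v, w] (form (complexify h)) = 0 := by
  have hH := isHomogeneous_form (complexify h)
  have h0 : ∀ w, eval ![-1, -Complex.I, w] (form (complexify h)) = 0 := fun w => by
    have := congrArg (Polynomial.eval w) (focalPoly_eq_zero hL hw)
    rw [focalPoly, polynomial_eval_aeval, Polynomial.eval_zero] at this
    rw [← this]
    congr 2
    ext i
    fin_cases i <;> simp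
  have h1 : ∀ v w, eval ![-Complex.I * v, v, w] (form (complexify h)) = 0 := fun v w => by
    -- The point `(0 : 0 : 1)` is not a multiple of any `(-1, -i, w)`. There the vanishing comes
    -- from the `w ^ c` coefficient.
    by_cases hv : v = 0
    · have e : ![-Complex.I * v, v, w] = w • ![0, 0, 1] := by
        ext i
        fin_cases i <;> simp [hv]
      rw [e, eval_smul_of_isHomogeneous hH, eval_form_wTop, complexify, hw, Complex.ofReal_zero,
        mul_zero]
    · have e : ![-Complex.I * v, v, w] =
          (Complex.I * v) • ![-1, -Complex.I, w / (Complex.I * v)] := by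
        ext i
        fin_cases i
        · simp
        · simp only [Pi.smul_apply, smul_eq_mul, Fin.mk_one, Matrix.cons_val]
          linear_combination v * Complex.I_mul_I
        · simp only [Pi.smul_apply, smul_eq_mul, Fin.reduceFinMk, Matrix.cons_val]
          rw [mul_div_cancel₀ _ (mul_ne_zero Complex.I_ne_zero hv)]
      rw [e, eval_smul_of_isHomogeneous hH, h0, mul_zero]
  have hκ' : (κ - Complex.I) * (κ + Complex.I) = 0 := by
    linear_combination hκ - Complex.I_mul_I
  rcases mul_eq_zero.mp hκ' with hk | hk
  · rw [sub_eq_zero.mp hk]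
    -- The line `u = i v` is conjugate to `u = -i v`, and the form has real coefficients.
    apply (starRingEnd ℂ).injective
    rw [form_complexify, conj_eval_map, map_zero, ← form_complexify,
      ← h1 (starRingEnd ℂ v) (starRingEnd ℂ w)]
    congr 2
    ext i
    fin_cases i <;> simp
  · rw [eq_neg_of_add_eq_zero_left hk]
    exact h1 v w

/-! ### Tangent spaces -/

theorem exists_real_imaginary {σ : Type*} (f : MvPolynomial σ ℂ) :
    ∃ f₁ f₂ : MvPolynomial σ ℝ,
      f = map Complex.ofRealHom f₁ + C Complex.I * map Complex.ofRealHom f₂ := by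
  induction f using MvPolynomial.induction_on with
  | C z =>
    refine ⟨C z.re, C z.im, ?_⟩
    rw [map_C, map_C, ← C_mul, ← C_add]
    congr 1
    rw [mul_comm]
    exact (Complex.re_add_im z).symm
  | add f g hf hg =>
    obtain ⟨f₁, f₂, rfl⟩ := hf
    obtain ⟨g₁, g₂, rfl⟩ := hg
    refine ⟨f₁ + g₁, f₂ + g₂, ?_⟩
    rw [map_add, map_add]
    ring
  | mul_X f n hf =>
    obtain ⟨f₁, f₂, rfl⟩ := hf
    refine ⟨f₁ * X n, f₂ * X n, ?_⟩
    rw [map_mul, map_mul, map_X]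
    ring

theorem eval_complexify {c : ℕ} (b : Mono c → ℝ) (f : MvPolynomial (Mono c) ℝ) :
    eval (complexify b) (map Complex.ofRealHom f) = (eval b f : ℂ) := by
  rw [eval_map, eval₂_eq', eval_eq', Complex.ofReal_sum]
  simp [complexify]

/-- A complex polynomial vanishing on the family splits into two real polynomials, both vanishing on
`W`. -/
theorem complexify_mem_tangent {c d : ℕ} {W : Set (Mono c → ℝ)} (hW : W ⊆ realFamily c d)
    {a h : Mono c → ℝ} (hh : h ∈ tangent W a) :
    complexify h ∈ tangent (family c d) (complexify a) := by
  intro f hf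
  obtain ⟨f₁, f₂, rfl⟩ := exists_real_imaginary f
  have hvan : ∀ b ∈ W, eval b f₁ = 0 ∧ eval b f₂ = 0 := fun b hb => by
    have := mem_vanishingIdeal_iff.mp hf (complexify b) (hW hb)
    rw [aeval_eq_eval, map_add, map_mul, eval_C, eval_complexify, eval_complexify] at this
    have h1 := congrArg Complex.re this
    have h2 := congrArg Complex.im this
    simp at h1 h2
    exact ⟨h1, h2⟩
  have h₁ := hh f₁ (mem_vanishingIdeal_iff.mpr fun b hb => by
    rw [aeval_eq_eval]; exact (hvan b hb).1)
  have h₂ := hh f₂ (mem_vanishingIdeal_iff.mpr fun b hb => by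
    rw [aeval_eq_eval]; exact (hvan b hb).2)
  have k₁ := congrArg (Complex.ofReal) h₁
  have k₂ := congrArg (Complex.ofReal) h₂
  simp only [Complex.ofReal_sum, Complex.ofReal_mul, Complex.ofReal_zero] at k₁ k₂
  have e : ∀ m, eval (complexify a) (pderiv m (map Complex.ofRealHom f₁ +
      C Complex.I * map Complex.ofRealHom f₂)) * complexify h m =
      (eval a (pderiv m f₁) : ℂ) * (h m : ℂ) +
        Complex.I * ((eval a (pderiv m f₂) : ℂ) * (h m : ℂ)) := fun m => by
    rw [map_add, pderiv_C_mul, pderiv_map, pderiv_map, map_add, map_mul, eval_C,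
      eval_complexify, eval_complexify, complexify]
    ring
  simp only [e, Finset.sum_add_distrib, ← Finset.mul_sum, k₁, k₂, mul_zero, add_zero]

theorem idealTangent_sup {K σ : Type*} [Field K] [Fintype σ] (I J : Ideal (MvPolynomial σ K))
    (a : σ → K) : idealTangent (I ⊔ J) a = idealTangent I a ⊓ idealTangent J a := by
  apply le_antisymm
  · exact fun h hh => ⟨fun f hf => hh f (Ideal.mem_sup_left hf),
      fun f hf => hh f (Ideal.mem_sup_right hf)⟩
  · rintro h ⟨h1, h2⟩ f hf
    obtain ⟨f₁, hf₁, f₂, hf₂, rfl⟩ := Submodule.mem_sup.mp hf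
    simp only [map_add, add_mul, Finset.sum_add_distrib, h1 f₁ hf₁, h2 f₂ hf₂, add_zero]

/-- A polynomial `f` in the ideal vanishes identically along the line, and the coefficient of `t` in
`f (a + t h)` is its derivative in direction `h`. -/
theorem mem_idealTangent_of_line {σ : Type*} [Fintype σ] {S : Set (σ → ℝ)} {a h : σ → ℝ}
    (hS : ∀ t : ℝ, a + t • h ∈ S) : h ∈ idealTangent (vanishingIdeal ℝ S) a := by
  intro f hf
  have hvan : ∀ t : ℝ, eval (a + t • h) f = 0 := fun t => by
    rw [← aeval_eq_eval]
    exact mem_vanishingIdeal_iff.mp hf _ (hS t)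
  have hC : ∀ F : MvPolynomial σ ℝ, aeval (fun i => Polynomial.C (a i)) F
      = Polynomial.C (eval a F) := fun F => by
    apply Polynomial.funext
    intro t
    rw [polynomial_eval_aeval]
    simp
  have := taylor_one f (fun i => Polynomial.C (a i)) (fun i => Polynomial.X * Polynomial.C (h i))
    (Ideal.span {Polynomial.X ^ 2}) (fun i j => by
      rw [Ideal.mem_span_singleton]
      exact ⟨Polynomial.C (h i) * Polynomial.C (h j), by ring⟩)
  have h0 : aeval ((fun i => Polynomial.C (a i)) + fun i => Polynomial.X * Polynomial.C (h i)) f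
      = 0 := by
    apply Polynomial.funext
    intro t
    rw [polynomial_eval_aeval, Polynomial.eval_zero, ← hvan t]
    congr 2
    ext i
    simp
    ring
  have ha : eval a f = 0 := by simpa using hvan 0
  rw [h0, hC, ha, Polynomial.C_0, sub_zero, zero_sub, Ideal.mem_span_singleton, dvd_neg] at this
  have e : ∑ i, aeval (fun i => Polynomial.C (a i)) (pderiv i f) *
      (Polynomial.X * Polynomial.C (h i)) =
      Polynomial.C (∑ i, eval a (pderiv i f) * h i) * Polynomial.X := by
    rw [map_sum, Finset.sum_mul]
    refine Finset.sum_congr rfl fun i _ => ?_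
    rw [hC, Polynomial.C_mul]
    ring
  rw [e, Polynomial.X_pow_dvd_iff] at this
  simpa using this 1 (by norm_num)

/-- The affine polynomial `ℓ - ℓ a` belongs to the vanishing ideal, and its differential is `ℓ`. -/
theorem apply_eq_zero_of_mem_idealTangent {σ : Type*} [Fintype σ] {S : Set (σ → ℝ)}
    {a h : σ → ℝ} (ℓ : (σ → ℝ) →ₗ[ℝ] ℝ) (hS : ∀ b ∈ S, ℓ b = ℓ a)
    (hh : h ∈ idealTangent (vanishingIdeal ℝ S) a) : ℓ h = 0 := by
  classical
  have hℓ : ∀ b, ∑ m, ℓ (Pi.single m 1) * b m = ℓ b := fun b => by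
    conv_rhs => rw [pi_eq_sum_univ' b, map_sum]
    exact Finset.sum_congr rfl fun m _ => by rw [map_smul, smul_eq_mul, mul_comm]
  have := hh (∑ m, C (ℓ (Pi.single m 1)) * X m - C (ℓ a)) (mem_vanishingIdeal_iff.mpr fun b hb => by
    rw [aeval_eq_eval]
    simp [hℓ, hS b hb])
  rw [← hℓ, ← this]
  refine Finset.sum_congr rfl fun m _ => ?_
  congr 1
  simp [pderiv_X, Pi.single_apply, mul_ite]

theorem confocalTangent_eq {c : ℕ} (W : Set (Mono c → ℝ)) (a : Mono c → ℝ) :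
    confocalTangent W a = tangent W a ⊓ LinearMap.ker (focalLinear c) := by
  rw [confocalTangent, idealTangent_sup, tangent]
  congr 1
  apply le_antisymm
  · intro h hh
    have key : ∀ (ℓ : ℂ →ₗ[ℝ] ℝ) (k : Fin c), ℓ (focalLinear c h k) = 0 := fun ℓ k =>
      apply_eq_zero_of_mem_idealTangent (ℓ ∘ₗ LinearMap.proj k ∘ₗ focalLinear c) (fun b hb => by
        have hb' : focalMap c b = focalMap c a := hb
        rw [focalMap_eq, focalMap_eq] at hb'
        simp only [LinearMap.comp_apply, hb']) hh
    rw [LinearMap.mem_ker]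
    ext k
    exact Complex.ext (key Complex.reLm k) (key Complex.imLm k)
  · intro h hh
    refine mem_idealTangent_of_line fun t => ?_
    change focalMap c (a + t • h) = focalMap c a
    rw [focalMap_eq, focalMap_eq, map_add, map_smul, LinearMap.mem_ker.mp hh,
      smul_zero, add_zero]

theorem expectedConfocalDim_eq {c : ℕ} (W : Set (Mono c → ℝ)) (a : Mono c → ℝ) :
    expectedConfocalDim W a = Module.finrank ℝ (LinearMap.ker (focalDifferential W a)) := by
  rw [expectedConfocalDim, confocalTangent_eq, focalDifferential_eq,
    ← Submodule.finrank_map_subtype_eq, LinearMap.ker_domRestrict, Submodule.map_comap_subtype]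

/-! ### The dimension of the kernel -/

/-- The equiclassical sections of degree `c` vanishing on the conic `u² + v² = 0`. -/
def isotropicEquiclassicalSections {c : ℕ} (G : MvPolynomial (Fin 3) ℂ) :
    Submodule ℂ (Mono c → ℂ) where
  carrier := {h | InEquiclassicalIdeal G (form h) ∧
    ∀ κ : ℂ, κ ^ 2 = -1 → ∀ v w, eval ![κ * v, v, w] (form h) = 0}
  zero_mem' := by
    have : form (0 : Mono c → ℂ) = 0 := by simp [form]
    simp [this, InEquiclassicalIdeal, grad]
  add_mem' := by
    rintro h k ⟨⟨h1, h2⟩, h3⟩ ⟨⟨k1, k2⟩, k3⟩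
    simp only [Set.mem_ofPred_eq, form_add, InEquiclassicalIdeal, grad, map_add]
    refine ⟨⟨fun p hp => ?_, fun p hp => ⟨?_, fun v hv => ?_⟩⟩, fun κ hκ v w => ?_⟩
    · rw [h1 p hp, k1 p hp, add_zero]
    · rw [(h2 p hp).1, (k2 p hp).1, add_zero]
    · have e1 := (h2 p hp).2 v hv
      have e2 := (k2 p hp).2 v hv
      simp only [grad] at e1 e2
      simp only [add_mul, Finset.sum_add_distrib, e1, e2, add_zero]
    · rw [h3 κ hκ, k3 κ hκ, add_zero]
  smul_mem' := by
    rintro r h ⟨⟨h1, h2⟩, h3⟩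
    simp only [Set.mem_ofPred_eq, form_smul, InEquiclassicalIdeal, grad, Derivation.map_smul,
      smul_eval]
    refine ⟨⟨fun p hp => ?_, fun p hp => ⟨?_, fun v hv => ?_⟩⟩, fun κ hκ v w => ?_⟩
    · rw [h1 p hp, mul_zero]
    · rw [(h2 p hp).1, mul_zero]
    · have e1 := (h2 p hp).2 v hv
      simp only [grad] at e1
      simp only [mul_assoc, ← Finset.mul_sum, e1, mul_zero]
    · rw [h3 κ hκ, mul_zero]

/-- A real basis stays independent over `ℂ`: separate a complex relation into real and imaginary
parts. -/
theorem finrank_le_of_complexify {c : ℕ} (K : Submodule ℝ (Mono c → ℝ))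
    (V : Submodule ℂ (Mono c → ℂ)) (h : ∀ a ∈ K, complexify a ∈ V) :
    Module.finrank ℝ K ≤ Module.finrank ℂ V := by
  set b := Module.finBasis ℝ K
  have hli : LinearIndependent ℂ (fun i => (⟨complexify (b i).1, h _ (b i).2⟩ : V)) := by
    rw [Fintype.linearIndependent_iff]
    intro g hg
    have hg' : ∀ m, ∑ i, g i * ((b i).1 m : ℂ) = 0 := fun m => by
      have := congr_fun (congrArg Subtype.val hg) m
      simpa [complexify] using this
    have hb := Fintype.linearIndependent_iff.mp b.linearIndependent
    have hre := hb (fun i => (g i).re) (by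
      apply Subtype.ext
      ext m
      have := congrArg Complex.re (hg' m)
      simpa using this)
    have him := hb (fun i => (g i).im) (by
      apply Subtype.ext
      ext m
      have := congrArg Complex.im (hg' m)
      simpa using this)
    exact fun i => Complex.ext (hre i) (him i)
  simpa using hli.fintype_card_le_finrank

/-- A form of degree zero is a constant, hence not irreducible. -/
theorem degree_pos_of_mem_family {c d : ℕ} {a : Mono c → ℂ} (ha : a ∈ family c d) : 0 < c := by
  rcases Nat.eq_zero_or_pos c with rfl | h
  · exfalso
    have hirr := ha.2.1
    obtain ⟨r, hr⟩ : ∃ r, form a = C r :=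
      ⟨_, totalDegree_eq_zero_iff_eq_C.mp (Nat.le_zero.mp (isHomogeneous_form a).totalDegree_le)⟩
    apply hirr.not_isUnit
    rw [hr]
    refine IsUnit.map C (isUnit_iff_ne_zero.mpr ?_)
    rintro rfl
    exact hirr.ne_zero (by rw [hr, C_0])
  · exact h

theorem finrank_confocalTangent_le {c d : ℕ} {W : Set (Mono c → ℝ)} (hW : W ⊆ realFamily c d)
    {a : Mono c → ℝ} (ha : a ∈ W) (htan : TangentDescription c d (complexify a))
    (hnc : IsNodalCuspidal (form (complexify a)))
    (hsing : SingDisjointFromIsotropic (form (complexify a))) :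
    Module.finrank ℝ (confocalTangent W a) ≤ d + 1 - c := by
  refine (finrank_le_of_complexify _
    (isotropicEquiclassicalSections (form (complexify a))) fun h hh => ?_).trans
    (finrank_equiclassical_le (complexify a) (hW ha) (degree_pos_of_mem_family (hW ha)) hnc hsing
      _ (fun h hh => hh.1) (fun h hh => hh.2))
  rw [confocalTangent_eq] at hh
  obtain ⟨h1, h2⟩ := (htan _).mp (complexify_mem_tangent hW hh.1)
  have hw : h (wTop c) = 0 := Complex.ofReal_eq_zero.mp h1
  exact ⟨h2, fun κ hκ v w => eval_isotropic_eq_zero (LinearMap.mem_ker.mp hh.2) hw κ hκ v w⟩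

/-- Irreducibility makes two nonempty open subsets meet: a product of two polynomials outside a
prime ideal stays outside. -/
theorem Generally.and {K σ : Type*} [Field K] {W : Set (σ → K)}
    (hW : (vanishingIdeal K W).IsPrime) {P Q : (σ → K) → Prop} (hP : Generally W P)
    (hQ : Generally W Q) : Generally W (fun a => P a ∧ Q a) := by
  obtain ⟨f, ⟨a, ha, hfa⟩, hf⟩ := hP
  obtain ⟨g, ⟨b, hb, hgb⟩, hg⟩ := hQ
  refine ⟨f * g, ?_, fun x hx hfg => ?_⟩
  · by_contra! h
    rcases hW.mem_or_mem (mem_vanishingIdeal_iff.mpr fun x hx => by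
      rw [aeval_eq_eval]; exact h x hx) with h' | h'
    · exact hfa (by rw [← aeval_eq_eval]; exact mem_vanishingIdeal_iff.mp h' a ha)
    · exact hgb (by rw [← aeval_eq_eval]; exact mem_vanishingIdeal_iff.mp h' b hb)
  · rw [map_mul] at hfg
    exact ⟨hf x hx (left_ne_zero_of_mul hfg), hg x hx (right_ne_zero_of_mul hfg)⟩

end Confocal

end

theorem mainTheorem1 (c d : ℕ) (W : Set (Confocal.Mono c → ℝ))
    (hW : Confocal.IsIrredComponent (Confocal.realFamily c d) W)
    (hsmooth : Confocal.Generally W (Confocal.IsSmoothOfDim W (c + d + 1)))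
    (htangent : Confocal.Generally W
      (fun a => Confocal.TangentDescription c d (Confocal.complexify a)))
    (hnodal : Confocal.Generally W (fun a =>
      Confocal.IsNodalCuspidal (Confocal.form (Confocal.complexify a)) ∧
      Confocal.SingDisjointFromIsotropic (Confocal.form (Confocal.complexify a)))) :
    Confocal.Generally W (fun a =>
      Confocal.IsSmoothOfDim W (c + d + 1) a ∧
      (Module.finrank ℝ (LinearMap.ker (Confocal.focalDifferential W a)) : ℤ)
        = max 0 ((d : ℤ) - c + 1) ∧
      Module.finrank ℝ (LinearMap.range (Confocal.focalDifferential W a))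
        = min (2 * c) (c + d + 1) ∧
      (Confocal.expectedConfocalDim W a : ℤ) = max 0 ((d : ℤ) - c + 1)) := by
  obtain ⟨hsub, hprime⟩ := hW.prop
  obtain ⟨f, hf, h⟩ := (hsmooth.and hprime htangent).and hprime hnodal
  refine ⟨f, hf, fun a ha hfa => ?_⟩
  obtain ⟨⟨hsm, htan⟩, hnc, hsing⟩ := h a ha hfa
  have hle := Confocal.finrank_confocalTangent_le hsub ha htan hnc hsing
  rw [← Confocal.expectedConfocalDim] at hle
  have heq := Confocal.expectedConfocalDim_eq W a
  have hsum := LinearMap.finrank_range_add_finrank_ker (Confocal.focalDifferential W a)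
  rw [hsm.2] at hsum
  have hrange := Submodule.finrank_le (LinearMap.range (Confocal.focalDifferential W a))
  rw [finrank_real_of_complex, Module.finrank_fin_fun] at hrange
  -- The nullity is at most `d + 1 - c`, the rank at most `2 * c`, and their sum is `c + d + 1`.
  -- These force both values, in the case `c ≤ d + 1` as well as in the case `c > d + 1`.
  refine ⟨hsm, ?_, ?_, ?_⟩ <;> omega
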